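/- Let $q\in\mathbb{C}$ with $0<|q|<1$ and let $a,b\in\mathbb{C}$. Write $(x;q)_n=\prod_{k=0}^{n-1}(1-xq^k)$ and $(x;q)_\infty=\prod_{k=0}^{\infty}(1-xq^k)$. Consider the formal series $$\hat w(z)={}_2\phi_0(a,b;-;q;z)=\sum_{n\ge 0}\hat w_nz^n,\qquad \hat w_n=\frac{(a;q)_n(b;q)_n}{(q;q)_n}(-1)^nq^{-n(n-1)/2}.$$ Its $q$-Borel transform is $B(t)=\sum_{n\ge0}\hat w_n q^{n(n-1)/2}t^n$. Then the following hold. 1. The series $B$ converges for $|t|<1$ and equals ${}_2\phi_1(a,b;0;q;-t)=\sum_{n\ge0}\frac{(a;q)_n(b;q)_n}{(q;q)_n}(-t)^n$. It continues to a meromorphic function on $\mathbb{C}$, again denoted $B$, which is analytic away from the points $-q^{-j}$, $j=0,1,2,\dots$. There are $d_j\in\mathbb{C}$ such that $B(t)-\dfrac{d_j}{1+tq^j}$ is analytic at $-q^{-j}$; in particular $-q^{-j}$ is a simple pole of $B$ whenever $d_j\neq0$. With $d_{-1}=0$ one has $$d_0=\frac{(a;q)_\infty(b;q)_\infty}{(q;q)_\infty},\qquad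 (1-q^{-j})d_j=(1-(a+b)q^{-j})d_{j-1}+abq^{-j}d_{j-2}\quad(j\ge1).$$ 2. As $n\to\infty$, $\dfrac{(a;q)_n(b;q)_n}{(q;q)_n}\sim\sum_{j=0}^\infty d_jq^{jn}$; that is, for every $J\ge 0$ the difference between the left side and $\sum_{j<J}d_jq^{jn}$ is $O(q^{Jn})$. Now let $0<q<1$. Let $z$ range over the Riemann surface of the logarithm, and put $$C_q=\frac1{\sqrt{-2\pi\ln q}},\qquad E_q(\tau)=\exp\left(\frac{(\ln(\tau/\sqrt q))^2}{2\ln q}\right),\qquad w(z)=C_q\int_0^\infty B(t)\,E_q(t/z)\frac{dt}{t}.$$ For $\sigma>0$ and $N\in\mathbb{Z}$ let $$F_q(z;N,\sigma)=\sigma^{1-N}C_q\int_0^\infty\frac{t^{N-1}E_q(t)}{t+\sigma z}\,dt\qquad(|\arg z|<\pi).$$ 3. The integral for $w(z)$ converges absolutely for every $z$. 4. (Stokes phenomenon.) For every $z$ on the Riemann surface, with $-1/z$ read as $e^{\pi i}/z$, $$w(e^{-2\pi i}z)-w(z)=2\pi i\,C_q\,E_q(-1/z)\sum_{n=0}^\infty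 d_n\,q^{n(n+1)/2}(-z)^n,$$ where the series converges. In particular this is an asymptotic expansion as $z\to0$: for every $M\ge 0$, truncating the sum to $n<M$ leaves an error $O(E_q(-1/z)z^M)$, uniformly in $\arg z$. 5. (Re-expansion.) For integers $N\ge0$ and $j\ge 0$ the integral defining $F_q(1/z;N,q^{-j})$ converges absolutely for $|\arg z|<\pi$, and $F_q(1/z;N,q^{-j})$ continues analytically in $z$ to the whole Riemann surface. If $N\ge0$ satisfies $|a|q^N<1$ and $|b|q^N<1$, then for every $z$ on the surface $$w(z)=\sum_{n=0}^{N-1}\frac{(a;q)_n(b;q)_n}{(q;q)_n}q^{-n(n-1)/2}(-z)^n-(-z)^{N-1}\sum_{j=0}^\infty d_j\,F_q\left(\frac1z;N,q^{-j}\right),$$ where the series over $j$ converges. 6. (Exponential improvement.) For all $\Theta,K\in\mathbb{R}$ and every integer $J\ge0$ there are constants $C$ and $r>0$ such that, whenever $|\arg z|\le\Theta$, $|z|<r$ and the integer $N\ge0$ satisfies $\bigl|N-|\ln z/\ln q|\bigr|\le K$, truncating the sum over $j$ in the formula of part 5 to $j<J$ leaves an error of absolute value at most $C\,E_q(1/|z|)\,|z|^J$.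 -/

import Mathlib

open scoped BigOperators

namespace QSeries

/-- The finite `q`-shifted factorial `(a;q)_n = (1-a)(1-aq)⋯(1-aq^{n-1})`. -/
def qPoch (a q : ℂ) (n : ℕ) : ℂ := ∏ k ∈ Finset.range n, (1 - a * q ^ k)

/-- The infinite `q`-shifted factorial `(a;q)_∞`, for `|q| < 1`. -/
noncomputable def qPochInf (a q : ℂ) : ℂ := ∏' k : ℕ, (1 - a * q ^ k)

/-- The coefficient of `z ^ n` in the basic hypergeometric series
`_rφ_s(a_1,…,a_r; b_1,…,b_s; q; z)`. -/
noncomputable def phiCoeff (as bs : List ℂ) (q : ℂ) (n : ℕ) : ℂ :=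
  (as.map fun a => qPoch a q n).prod / ((bs.map fun b => qPoch b q n).prod * qPoch q q n) *
    ((-1) ^ n * q ^ (n * (n - 1) / 2)) ^ (1 + (bs.length : ℤ) - (as.length : ℤ))

/-- `_rφ_s(a_1,…,a_r; b_1,…,b_s; q; z)` as a formal power series in `z`. -/
noncomputable def phiSeries (as bs : List ℂ) (q : ℂ) : PowerSeries ℂ :=
  PowerSeries.mk (phiCoeff as bs q)

/-- The formal `q`-Borel transform `∑ a_n z^n ↦ ∑ a_n q^{n(n-1)/2} t^n`. -/
noncomputable def qBorel (q : ℂ) (f : PowerSeries ℂ) : PowerSeries ℂ :=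
  PowerSeries.mk fun n => PowerSeries.coeff n f * q ^ (n * (n - 1) / 2)

/-- The constant `C_q = 1 / √(-2π ln q)`, for `0 < q < 1`. -/
noncomputable def lapConst (q : ℝ) : ℝ := 1 / Real.sqrt (-(2 * Real.pi * Real.log q))

/-- The function `E_q(τ) = exp ((ln (τ / √q))² / (2 ln q))` on the Riemann surface of the
logarithm, in the coordinate `l = ln τ ∈ ℂ`. -/
noncomputable def gaussE (q : ℝ) (l : ℂ) : ℂ :=
  Complex.exp ((l - (Real.log q : ℂ) / 2) ^ 2 / (2 * (Real.log q : ℂ)))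

/-- The integrand `B(t) E_q(t/z) / t` of the `q`-Laplace transform, at the point `z = e^l` of the
Riemann surface of the logarithm. -/
noncomputable def laplaceIntegrand (q : ℝ) (B : ℂ → ℂ) (l : ℂ) (t : ℝ) : ℂ :=
  B (t : ℂ) * gaussE q ((Real.log t : ℂ) - l) / (t : ℂ)

/-- The `q`-Laplace transform `w(z) = C_q ∫_0^∞ B(t) E_q(t/z) dt/t`, at the point `z = e^l` of the
Riemann surface of the logarithm. -/
noncomputable def qLaplace (q : ℝ) (B : ℂ → ℂ) (l : ℂ) : ℂ :=
  (lapConst q : ℂ) * ∫ t in Set.Ioi (0 : ℝ), laplaceIntegrand q B l t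

/-- The integrand `t^{N-1} E_q(t) / (t + σ z)` of the `q`-hyperterminant. -/
noncomputable def hyperIntegrand (q : ℝ) (z : ℂ) (N : ℤ) (σ : ℂ) (t : ℝ) : ℂ :=
  (t : ℂ) ^ (N - 1) * gaussE q (Real.log t : ℂ) / ((t : ℂ) + σ * z)

/-- The `q`-hyperterminant
`F_q(z; N, σ) = σ^{1-N} C_q ∫_0^∞ t^{N-1} E_q(t) / (t + σ z) dt`, for `|arg (σ z)| < π`
and integer `N`. -/
noncomputable def hyperterminant (q : ℝ) (z : ℂ) (N : ℤ) (σ : ℂ) : ℂ :=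
  σ ^ (1 - N) * (lapConst q : ℂ) * ∫ t in Set.Ioi (0 : ℝ), hyperIntegrand q z N σ t

/-- `Φ` is the analytic continuation of `z ↦ F_q(1/z; N, σ)`, for `σ > 0`, from `|arg z| < π` to
the whole Riemann surface of the logarithm, in the coordinate `l = ln z ∈ ℂ`. -/
def IsHyperterminantContinuation (q : ℝ) (N : ℤ) (σ : ℝ) (Φ : ℂ → ℂ) : Prop :=
  Differentiable ℂ Φ ∧
    ∀ l : ℂ, |l.im| < Real.pi →
      MeasureTheory.IntegrableOn (hyperIntegrand q (1 / Complex.exp l) N (σ : ℂ))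
          (Set.Ioi (0 : ℝ)) ∧
        Φ l = hyperterminant q (1 / Complex.exp l) N (σ : ℂ)

end QSeries

/-!
Let `c_n = (a;q)_n (b;q)_n / (q;q)_n`. Everything rests on one fact (`hasSum_lateCoeff`): as soon
as `|a q^n| < 1` and `|b q^n| < 1`, the coefficient `c_n` is *equal* to the convergent series
`∑ d_j q^{jn}`, where `∑ d_j x^j` is the Taylor series of
`G(x) = d_0 (qx;q)_∞ / ((ax;q)_∞ (bx;q)_∞)`. Indeed `(1 - qx) G(qx) = (1 - ax)(1 - bx) G(x)`,
which read coefficientwise is the recurrence for the `d_j`, and read at `x = q^n` says that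
`G(q^n)` and `c_n` obey the same first-order recurrence; both tend to `d_0`, so they agree. The
series `G` is built as a formal product, so that its `q`-difference equation is an identity in
`ℂ⟦X⟧`.

Splitting off the first `N` coefficients and summing geometric series gives the continuation of
the `q`-Borel transform (`borelSum`),
`B(t) = ∑_{n<N} c_n (-t)^n + (-t)^N ∑_j d_j q^{jN} / (1 + t q^j)`,
from which its poles and principal parts are read off.

For `0 < q < 1` the substitution `t = e^u` turns the `q`-Laplace transform into an integral over the
real line against a Gaussian. The monomials give `q^{-n(n-1)/2} (-z)^n`, and the `j`-th partial
fraction gives `poleIntegral` (`hasSum_qLaplace`), an entire function of `l = ln z` because it is, up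
to an elementary factor, the Laplace transform of a density with Gaussian decay.
Moving the line of integration without crossing a pole identifies `poleIntegral` with the
hyperterminant for `|arg z| < π` (`integral_poleKernel_add`), which gives the re-expansion. Going
once around the origin moves the line by `2πi` across the single pole `u = iπ - j ln q`, and the
residue there is the `j`-th term of the Stokes series (`poleIntegral_sub`).

For the exponential improvement no analytic continuation is needed: on the real line
`|1 + q^j e^u| ≥ 1`, so `poleIntegral` is bounded by a Gaussian moment for every value of `arg z`, and
completing the square at `N ≈ ln |z| / ln q` gives the bound (`exists_remainder_bound`).
-/

namespace QSeries

open Filter Topology MeasureTheory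

/-! ### The shifted factorials and the late coefficients -/

/-- The coefficient `(a;q)_n (b;q)_n / (q;q)_n` of `_2φ_1(a,b;0;q;x)`. -/
noncomputable def lateCoeff (a b q : ℂ) (n : ℕ) : ℂ := qPoch a q n * qPoch b q n / qPoch q q n

lemma qPoch_succ (a q : ℂ) (n : ℕ) : qPoch a q (n + 1) = qPoch a q n * (1 - a * q ^ n) := by
  simp [qPoch, Finset.prod_range_succ]

lemma qPoch_add (a q : ℂ) (n m : ℕ) :
    qPoch a q (n + m) = qPoch a q n * qPoch (a * q ^ n) q m := by
  simp only [qPoch, Finset.prod_range_add, pow_add, mul_assoc]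

lemma one_sub_mul_pow_ne_zero {a q : ℂ} (hq1 : ‖q‖ < 1) (ha : ‖a‖ < 1) (n : ℕ) :
    1 - a * q ^ n ≠ 0 := by
  intro h
  have h1 : ‖a * q ^ n‖ = 1 := by rw [← sub_eq_zero.1 h]; simp
  rw [norm_mul, norm_pow] at h1
  have : ‖q‖ ^ n ≤ 1 := pow_le_one₀ (norm_nonneg _) hq1.le
  nlinarith [norm_nonneg a]

lemma one_sub_pow_succ_ne_zero {q : ℂ} (hq1 : ‖q‖ < 1) (n : ℕ) : 1 - q ^ (n + 1) ≠ 0 := by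
  simpa [pow_succ'] using one_sub_mul_pow_ne_zero hq1 hq1 n

lemma qPoch_ne_zero {a q : ℂ} (hq1 : ‖q‖ < 1) (ha : ‖a‖ < 1) (n : ℕ) : qPoch a q n ≠ 0 :=
  Finset.prod_ne_zero_iff.2 fun _ _ => one_sub_mul_pow_ne_zero hq1 ha _

lemma summable_norm_mul_pow (a : ℂ) {q : ℂ} (hq1 : ‖q‖ < 1) :
    Summable fun k : ℕ => ‖-(a * q ^ k)‖ := by
  simpa using (summable_geometric_of_lt_one (norm_nonneg q) hq1).mul_left ‖a‖

lemma tendsto_qPoch (a : ℂ) {q : ℂ} (hq1 : ‖q‖ < 1) :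
    Tendsto (qPoch a q) atTop (𝓝 (qPochInf a q)) := by
  have h := (multipliable_one_add_of_summable (summable_norm_mul_pow a hq1)).hasProd.tendsto_prod_nat
  simp only [← sub_eq_add_neg] at h
  exact h

lemma qPochInf_ne_zero {a q : ℂ} (hq1 : ‖q‖ < 1) (ha : ‖a‖ < 1) : qPochInf a q ≠ 0 := by
  have h := tprod_one_add_ne_zero_of_summable (f := fun k : ℕ => -(a * q ^ k))
    (fun i => by simpa [← sub_eq_add_neg] using one_sub_mul_pow_ne_zero hq1 ha i)
    (summable_norm_mul_pow a hq1)
  simp only [← sub_eq_add_neg] at h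
  exact h

/-- The constant `(a;q)_∞ (b;q)_∞ / (q;q)_∞`, the limit of the coefficients `lateCoeff`. -/
noncomputable def leadCoeff (a b q : ℂ) : ℂ := qPochInf a q * qPochInf b q / qPochInf q q

lemma tendsto_lateCoeff (a b : ℂ) {q : ℂ} (hq1 : ‖q‖ < 1) :
    Tendsto (lateCoeff a b q) atTop (𝓝 (leadCoeff a b q)) :=
  ((tendsto_qPoch a hq1).mul (tendsto_qPoch b hq1)).div (tendsto_qPoch q hq1)
    (qPochInf_ne_zero hq1 hq1)

lemma lateCoeff_add (a b : ℂ) {q : ℂ} (hq1 : ‖q‖ < 1) (n m : ℕ) :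
    qPoch (q ^ (n + 1)) q m * lateCoeff a b q (n + m) =
      qPoch (a * q ^ n) q m * qPoch (b * q ^ n) q m * lateCoeff a b q n := by
  have h1 := qPoch_ne_zero hq1 hq1 n
  have h2 := qPoch_ne_zero hq1 hq1 (n + m)
  have h3 := qPoch_add q q n m
  rw [← pow_succ'] at h3
  have h4 : qPoch (q ^ (n + 1)) q m ≠ 0 := by
    rintro h; rw [h, mul_zero] at h3; exact h2 h3
  simp only [lateCoeff, qPoch_add a q n m, qPoch_add b q n m, h3]
  field_simp

/-! ### Evaluation of power series at points of absolute convergence -/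

/-- Absolute convergence of the power series `f` at `x`. -/
def AbsConv (f : PowerSeries ℂ) (x : ℂ) : Prop :=
  Summable fun n => ‖PowerSeries.coeff n f * x ^ n‖

/-- The sum of the power series `f` at `x`; meaningful under `AbsConv f x`. -/
noncomputable def psEval (f : PowerSeries ℂ) (x : ℂ) : ℂ := ∑' n, PowerSeries.coeff n f * x ^ n

lemma coeff_mul_mul_pow (f g : PowerSeries ℂ) (x : ℂ) (n : ℕ) :
    PowerSeries.coeff n (f * g) * x ^ n = ∑ kl ∈ Finset.HasAntidiagonal.antidiagonal n,
      (PowerSeries.coeff kl.1 f * x ^ kl.1) * (PowerSeries.coeff kl.2 g * x ^ kl.2) := by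
  rw [PowerSeries.coeff_mul, Finset.sum_mul]
  refine Finset.sum_congr rfl fun kl hkl => ?_
  rw [← Finset.HasAntidiagonal.mem_antidiagonal.1 hkl, pow_add]
  ring

lemma AbsConv.mul {f g : PowerSeries ℂ} {x : ℂ} (hf : AbsConv f x) (hg : AbsConv g x) :
    AbsConv (f * g) x := by
  simpa only [AbsConv, coeff_mul_mul_pow] using
    summable_norm_sum_mul_antidiagonal_of_summable_norm hf hg

lemma psEval_mul {f g : PowerSeries ℂ} {x : ℂ} (hf : AbsConv f x) (hg : AbsConv g x) :
    psEval (f * g) x = psEval f x * psEval g x := by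
  simpa only [psEval, coeff_mul_mul_pow] using
    (tsum_mul_tsum_eq_tsum_sum_antidiagonal_of_summable_norm hf hg).symm

lemma psEval_rescale (f : PowerSeries ℂ) (q x : ℂ) :
    psEval (PowerSeries.rescale q f) x = psEval f (q * x) := by
  simp only [psEval, PowerSeries.coeff_rescale]
  exact tsum_congr fun n => by rw [mul_pow]; ring

lemma AbsConv.rescale {f : PowerSeries ℂ} {q x : ℂ} (h : AbsConv f (q * x)) :
    AbsConv (PowerSeries.rescale q f) x := by
  refine h.congr fun n => ?_
  rw [PowerSeries.coeff_rescale, mul_pow]; congr 1; ring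

/-- The linear factor `1 - aX`. -/
noncomputable def linFactor (a : ℂ) : PowerSeries ℂ := 1 - PowerSeries.C a * PowerSeries.X

lemma coeff_zero_linFactor_mul (a : ℂ) (f : PowerSeries ℂ) :
    PowerSeries.coeff 0 (linFactor a * f) = PowerSeries.coeff 0 f := by
  simp [linFactor]

lemma coeff_succ_linFactor_mul (a : ℂ) (f : PowerSeries ℂ) (n : ℕ) :
    PowerSeries.coeff (n + 1) (linFactor a * f) =
      PowerSeries.coeff (n + 1) f - a * PowerSeries.coeff n f := by
  rw [linFactor, sub_mul, one_mul, map_sub, mul_assoc, PowerSeries.coeff_C_mul,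
    PowerSeries.coeff_succ_X_mul]

lemma coeff_linFactor_of_two_le (a : ℂ) {n : ℕ} (hn : n ∉ Finset.range 2) :
    PowerSeries.coeff n (linFactor a) = 0 := by
  obtain ⟨m, rfl⟩ : ∃ m, n = m + 2 := ⟨n - 2, by simp at hn; omega⟩
  have := coeff_succ_linFactor_mul a 1 (m + 1)
  simpa [PowerSeries.coeff_one] using this

lemma absConv_linFactor (a x : ℂ) : AbsConv (linFactor a) x :=
  summable_of_ne_finset_zero (s := Finset.range 2) fun n hn => by
    rw [coeff_linFactor_of_two_le a hn]; simp

lemma psEval_linFactor (a x : ℂ) : psEval (linFactor a) x = 1 - a * x := by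
  have h1 := coeff_succ_linFactor_mul a 1 0
  have h0 := coeff_zero_linFactor_mul a 1
  rw [mul_one] at h0 h1
  rw [psEval, tsum_eq_sum (s := Finset.range 2) fun n hn => by
    rw [coeff_linFactor_of_two_le a hn]; simp]
  simp [Finset.sum_range_succ, h0, h1, PowerSeries.coeff_one, sub_eq_add_neg]

/-! ### The generating function of the residues -/

/-- The series `∑ a^k x^k / (q;q)_k`, which sums to `1 / (ax;q)_∞`. -/
noncomputable def qExp (a q : ℂ) : PowerSeries ℂ := PowerSeries.mk fun k => a ^ k / qPoch q q k

/-- The series `∑ (-1)^k q^{k(k+1)/2} x^k / (q;q)_k`, which sums to `(qx;q)_∞`. -/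
noncomputable def qExpInv (q : ℂ) : PowerSeries ℂ :=
  PowerSeries.mk fun k => (-1) ^ k * q ^ (k * (k + 1) / 2) / qPoch q q k

/-- The generating function `∑ d_j x^j` of the residue constants: the Taylor series of
`d_0 (qx;q)_∞ / ((ax;q)_∞ (bx;q)_∞)`. -/
noncomputable def residueSeries (a b q : ℂ) : PowerSeries ℂ :=
  PowerSeries.C (leadCoeff a b q) * (qExpInv q * (qExp a q * qExp b q))

lemma rescale_qExp (a : ℂ) {q : ℂ} (hq1 : ‖q‖ < 1) :
    PowerSeries.rescale q (qExp a q) = linFactor a * qExp a q := by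
  ext n
  rcases n with _ | n
  · rw [coeff_zero_linFactor_mul]; simp
  · rw [coeff_succ_linFactor_mul, PowerSeries.coeff_rescale]
    have h1 := qPoch_ne_zero hq1 hq1 n
    have h2 := one_sub_pow_succ_ne_zero hq1 n
    simp only [qExp, PowerSeries.coeff_mk, qPoch_succ, ← pow_succ']
    field_simp
    ring

lemma triangle_succ (k : ℕ) : (k + 1) * (k + 1 + 1) / 2 = k * (k + 1) / 2 + (k + 1) := by
  rw [show (k + 1) * (k + 1 + 1) = k * (k + 1) + (k + 1) * 2 by ring,
    Nat.add_mul_div_right _ _ two_pos]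

lemma linFactor_mul_rescale_qExpInv {q : ℂ} (hq1 : ‖q‖ < 1) :
    linFactor q * PowerSeries.rescale q (qExpInv q) = qExpInv q := by
  ext n
  rcases n with _ | n
  · rw [coeff_zero_linFactor_mul]; simp
  · rw [coeff_succ_linFactor_mul, PowerSeries.coeff_rescale, PowerSeries.coeff_rescale]
    have h1 := qPoch_ne_zero hq1 hq1 n
    have h2 := one_sub_pow_succ_ne_zero hq1 n
    have h3 : qPoch q q (n + 1) = qPoch q q n * (1 - q ^ (n + 1)) := by
      rw [qPoch_succ, ← pow_succ']
    have h4 : q * (q ^ n * ((-1) ^ n * q ^ (n * (n + 1) / 2) / qPoch q q n)) =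
        q ^ (n + 1) * ((-1) ^ n * q ^ (n * (n + 1) / 2) / qPoch q q n) := by ring
    simp only [qExpInv, PowerSeries.coeff_mk, h3, h4, triangle_succ]
    rw [pow_add q (n * (n + 1) / 2), pow_succ (-1 : ℂ)]
    generalize q ^ (n * (n + 1) / 2) = T
    generalize q ^ (n + 1) = Q at *
    field_simp
    ring

/-- The `q`-difference equation behind the recurrence for the residue constants. -/
lemma linFactor_mul_rescale_residueSeries (a b : ℂ) {q : ℂ} (hq1 : ‖q‖ < 1) :
    linFactor q * PowerSeries.rescale q (residueSeries a b q) =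
      linFactor a * (linFactor b * residueSeries a b q) := by
  have hC : PowerSeries.rescale q (PowerSeries.C (leadCoeff a b q)) =
      PowerSeries.C (leadCoeff a b q) := by
    ext n; rcases n with _ | n <;> simp [PowerSeries.coeff_C]
  simp only [residueSeries, map_mul, rescale_qExp a hq1, rescale_qExp b hq1, hC]
  linear_combination (PowerSeries.C (leadCoeff a b q) * (linFactor a * qExp a q) *
    (linFactor b * qExp b q)) * linFactor_mul_rescale_qExpInv hq1

/-- The residue constant `d_j`. -/
noncomputable def resCoeff (a b q : ℂ) (j : ℕ) : ℂ := PowerSeries.coeff j (residueSeries a b q)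

lemma resCoeff_zero (a b q : ℂ) : resCoeff a b q 0 = leadCoeff a b q := by
  simp [resCoeff, residueSeries, qExpInv, qExp, qPoch]

lemma resCoeff_one (a b : ℂ) {q : ℂ} (hq1 : ‖q‖ < 1) :
    q * resCoeff a b q 1 - q * resCoeff a b q 0 =
      resCoeff a b q 1 - (a + b) * resCoeff a b q 0 := by
  have h := congrArg (PowerSeries.coeff 1) (linFactor_mul_rescale_residueSeries a b hq1)
  rw [← zero_add 1] at h
  simp only [coeff_succ_linFactor_mul, PowerSeries.coeff_rescale, coeff_zero_linFactor_mul] at h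
  simp only [resCoeff, zero_add, pow_zero, pow_one, one_mul] at h ⊢
  linear_combination h

lemma resCoeff_add_two (a b : ℂ) {q : ℂ} (hq1 : ‖q‖ < 1) (n : ℕ) :
    q ^ (n + 2) * resCoeff a b q (n + 2) - q ^ (n + 2) * resCoeff a b q (n + 1) =
      resCoeff a b q (n + 2) - (a + b) * resCoeff a b q (n + 1) + a * b * resCoeff a b q n := by
  have h := congrArg (PowerSeries.coeff (n + 1 + 1)) (linFactor_mul_rescale_residueSeries a b hq1)
  simp only [coeff_succ_linFactor_mul, PowerSeries.coeff_rescale] at h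
  simp only [resCoeff]
  linear_combination h

lemma absConv_qExp {a q x : ℂ} (hq1 : ‖q‖ < 1) (hx : ‖a * x‖ < 1) : AbsConv (qExp a q) x := by
  have hb : (fun k => (qPoch q q k)⁻¹) =O[atTop] fun _ => (1 : ℝ) :=
    ((tendsto_qPoch q hq1).inv₀ (qPochInf_ne_zero hq1 hq1)).isBigO_one ℝ
  have h : (fun k => PowerSeries.coeff k (qExp a q) * x ^ k) =O[atTop] fun k => ‖a * x‖ ^ k := by
    have h2 : (fun k : ℕ => (a * x) ^ k) =O[atTop] fun k => ‖a * x‖ ^ k :=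
      Asymptotics.isBigO_of_le _ fun k => by simp
    refine (hb.mul h2).congr (fun k => ?_) (fun k => by simp)
    rw [qExp, PowerSeries.coeff_mk, mul_pow]; ring
  exact summable_of_isBigO_nat (summable_geometric_of_lt_one (norm_nonneg _) hx) h.norm_left

lemma absConv_qExpInv {q x : ℂ} (hq1 : ‖q‖ < 1) (hx : ‖x‖ ≤ 1) : AbsConv (qExpInv q) x := by
  have hqx : ‖q * x‖ < 1 := by
    rw [norm_mul]; nlinarith [norm_nonneg q, norm_nonneg x]
  refine (absConv_qExp hq1 hqx).of_nonneg_of_le (fun _ => norm_nonneg _) fun k => ?_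
  have hk : k ≤ k * (k + 1) / 2 := by
    rw [Nat.le_div_iff_mul_le two_pos]
    rcases k with _ | k <;> nlinarith
  have := pow_le_pow_of_le_one (norm_nonneg q) hq1.le hk
  simp only [qExp, qExpInv, PowerSeries.coeff_mk, norm_mul, norm_div, norm_pow, norm_neg, norm_one,
    one_pow, one_mul]
  gcongr

lemma absConv_residueSeries {a b q x : ℂ} (hq1 : ‖q‖ < 1) (hx : ‖x‖ ≤ 1) (ha : ‖a * x‖ < 1)
    (hb : ‖b * x‖ < 1) : AbsConv (residueSeries a b q) x := by
  refine AbsConv.mul ?_ ((absConv_qExpInv hq1 hx).mul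
    ((absConv_qExp hq1 ha).mul (absConv_qExp hq1 hb)))
  refine summable_of_ne_finset_zero (s := Finset.range 1) fun n hn => ?_
  have : n ≠ 0 := by simpa using hn
  simp [PowerSeries.coeff_C, this]

/-! ### The convergent expansion of the late coefficients -/

/-- The index `N` is past the initial range: `|a q^N| < 1` and `|b q^N| < 1`. -/
def IsLate (a b q : ℂ) (N : ℕ) : Prop := ‖a‖ * ‖q‖ ^ N < 1 ∧ ‖b‖ * ‖q‖ ^ N < 1

lemma IsLate.mono {a b q : ℂ} {N M : ℕ} (hq1 : ‖q‖ < 1) (h : IsLate a b q N) (hNM : N ≤ M) :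
    IsLate a b q M := by
  have := pow_le_pow_of_le_one (norm_nonneg q) hq1.le hNM
  exact ⟨lt_of_le_of_lt (by gcongr) h.1, lt_of_le_of_lt (by gcongr) h.2⟩

lemma exists_isLate (a b : ℂ) {q : ℂ} (hq1 : ‖q‖ < 1) : ∃ N, IsLate a b q N := by
  have h := tendsto_pow_atTop_nhds_zero_of_lt_one (norm_nonneg q) hq1
  have ha := (h.const_mul ‖a‖).eventually_lt_const (u := 1) (by simp)
  have hb := (h.const_mul ‖b‖).eventually_lt_const (u := 1) (by simp)
  exact (ha.and hb).exists

lemma norm_pow_le_one {q : ℂ} (hq1 : ‖q‖ < 1) (n : ℕ) : ‖q ^ n‖ ≤ 1 := by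
  rw [norm_pow]; exact pow_le_one₀ (norm_nonneg _) hq1.le

lemma IsLate.absConv {a b q : ℂ} {N : ℕ} (hq1 : ‖q‖ < 1) (h : IsLate a b q N) :
    AbsConv (residueSeries a b q) (q ^ N) :=
  absConv_residueSeries hq1 (norm_pow_le_one hq1 N) (by rw [norm_mul, norm_pow]; exact h.1)
    (by rw [norm_mul, norm_pow]; exact h.2)

lemma IsLate.summable_norm {a b q : ℂ} {N : ℕ} (hq1 : ‖q‖ < 1) (h : IsLate a b q N) :
    Summable fun j => ‖resCoeff a b q j‖ * ‖q‖ ^ (j * N) := by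
  refine (h.absConv hq1).congr fun j => ?_
  rw [norm_mul, resCoeff, ← pow_mul, norm_pow, mul_comm N]

lemma psEval_residueSeries_step {a b q : ℂ} {N : ℕ} (hq1 : ‖q‖ < 1) (h : IsLate a b q N) :
    (1 - q ^ (N + 1)) * psEval (residueSeries a b q) (q ^ (N + 1)) =
      (1 - a * q ^ N) * ((1 - b * q ^ N) * psEval (residueSeries a b q) (q ^ N)) := by
  have h1 := (h.mono hq1 N.le_succ).absConv hq1
  have h0 := h.absConv hq1
  rw [Nat.succ_eq_add_one, pow_succ'] at h1
  have := congrArg (psEval · (q ^ N)) (linFactor_mul_rescale_residueSeries a b hq1)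
  beta_reduce at this
  rw [psEval_mul (absConv_linFactor _ _) h1.rescale, psEval_rescale, psEval_linFactor,
    psEval_mul (absConv_linFactor _ _) ((absConv_linFactor _ _).mul h0),
    psEval_mul (absConv_linFactor _ _) h0, psEval_linFactor, psEval_linFactor, ← pow_succ'] at this
  exact this

lemma psEval_residueSeries_add {a b q : ℂ} {N : ℕ} (hq1 : ‖q‖ < 1) (h : IsLate a b q N) (m : ℕ) :
    qPoch (q ^ (N + 1)) q m * psEval (residueSeries a b q) (q ^ (N + m)) =
      qPoch (a * q ^ N) q m * qPoch (b * q ^ N) q m * psEval (residueSeries a b q) (q ^ N) := by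
  induction m with
  | zero => simp [qPoch]
  | succ m ih =>
    have hs := psEval_residueSeries_step hq1 (h.mono hq1 (Nat.le_add_right N m))
    rw [qPoch_succ, qPoch_succ, qPoch_succ, ← add_assoc, mul_assoc a, mul_assoc b, ← pow_add,
      ← pow_add, add_right_comm N 1 m]
    linear_combination qPoch (q ^ (N + 1)) q m * hs +
      (1 - a * q ^ (N + m)) * (1 - b * q ^ (N + m)) * ih

lemma tendsto_psEval_residueSeries (a b : ℂ) {q : ℂ} (hq1 : ‖q‖ < 1) :
    Tendsto (fun n => psEval (residueSeries a b q) (q ^ n)) atTop (𝓝 (leadCoeff a b q)) := by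
  obtain ⟨N, hN⟩ := exists_isLate a b hq1
  have h : Tendsto (fun n => psEval (residueSeries a b q) (q ^ n)) atTop
      (𝓝 (∑' j, if j = 0 then leadCoeff a b q else 0)) := by
    refine tendsto_tsum_of_dominated_convergence (hN.absConv hq1) (fun j => ?_) ?_
    · split_ifs with hj
      · subst hj
        simp only [pow_zero, mul_one]
        exact tendsto_const_nhds_iff.2 (resCoeff_zero a b q)
      · have := (tendsto_pow_atTop_nhds_zero_of_norm_lt_one hq1).pow j
        simpa [hj] using this.const_mul (PowerSeries.coeff j (residueSeries a b q))
    · filter_upwards [eventually_ge_atTop N] with n hn j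
      rw [norm_mul, norm_mul, norm_pow, norm_pow, norm_pow, norm_pow]
      have := pow_le_pow_of_le_one (norm_nonneg q) hq1.le hn
      gcongr
  simpa using h

/-- Late coefficients are given exactly by the convergent series `∑ d_j q^{jn}`: both sides obey
the same first-order recurrence in `n` and have the same limit as `n → ∞`. -/
lemma psEval_residueSeries_eq_lateCoeff {a b q : ℂ} {N : ℕ} (hq1 : ‖q‖ < 1)
    (h : IsLate a b q N) : psEval (residueSeries a b q) (q ^ N) = lateCoeff a b q N := by
  have hshift : Tendsto (fun m => N + m) atTop atTop := tendsto_add_atTop_nat N |>.congr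
    fun m => add_comm m N
  have h0 := (((tendsto_psEval_residueSeries a b hq1).sub (tendsto_lateCoeff a b hq1)).comp
    hshift)
  have h1 := (tendsto_qPoch (q ^ (N + 1)) hq1).mul h0
  have h2 := ((tendsto_qPoch (a * q ^ N) hq1).mul (tendsto_qPoch (b * q ^ N) hq1)).mul_const
    (psEval (residueSeries a b q) (q ^ N) - lateCoeff a b q N)
  have h3 := tendsto_nhds_unique (h1.congr fun m => by
    simp only [Function.comp_apply, mul_sub]
    rw [psEval_residueSeries_add hq1 h, lateCoeff_add a b hq1]) h2
  have ha : qPochInf (a * q ^ N) q ≠ 0 :=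
    qPochInf_ne_zero hq1 (by rw [norm_mul, norm_pow]; exact h.1)
  have hb : qPochInf (b * q ^ N) q ≠ 0 :=
    qPochInf_ne_zero hq1 (by rw [norm_mul, norm_pow]; exact h.2)
  rw [sub_self, mul_zero] at h3
  have := mul_eq_zero.1 h3.symm
  simpa [ha, hb, sub_eq_zero] using this

lemma hasSum_lateCoeff {a b q : ℂ} {N : ℕ} (hq1 : ‖q‖ < 1) (h : IsLate a b q N) :
    HasSum (fun j => resCoeff a b q j * q ^ (j * N)) (lateCoeff a b q N) := by
  rw [← psEval_residueSeries_eq_lateCoeff hq1 h]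
  have := (h.absConv hq1).of_norm.hasSum
  simpa only [← pow_mul, mul_comm N, psEval, resCoeff] using this

lemma IsLate.summable_norm_shift {a b q : ℂ} {N : ℕ} (hq0 : 0 < ‖q‖) (hq1 : ‖q‖ < 1)
    (hN : IsLate a b q N) (J : ℕ) :
    Summable fun j => ‖resCoeff a b q (j + J)‖ * ‖q‖ ^ (j * N) := by
  refine (((summable_nat_add_iff J).2 (hN.summable_norm hq1)).mul_right
    (‖q‖ ^ (J * N))⁻¹).congr fun j => ?_
  have : ‖q‖ ^ (J * N) ≠ 0 := by positivity
  rw [add_mul, pow_add]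
  field_simp

/-- The asymptotic expansion of the late coefficients. -/
lemma lateCoeff_sub_isBigO (a b : ℂ) {q : ℂ} (hq0 : 0 < ‖q‖) (hq1 : ‖q‖ < 1) (J : ℕ) :
    (fun n => lateCoeff a b q n - ∑ j ∈ Finset.range J, resCoeff a b q j * q ^ (j * n))
      =O[atTop] fun n => q ^ (J * n) := by
  obtain ⟨N, hN⟩ := exists_isLate a b hq1
  have hs' := hN.summable_norm_shift hq0 hq1 J
  refine Asymptotics.IsBigO.of_bound (∑' j, ‖resCoeff a b q (j + J)‖ * ‖q‖ ^ (j * N)) ?_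
  filter_upwards [eventually_ge_atTop N] with n hn
  have h1 := (hasSum_nat_add_iff' J).2 (hasSum_lateCoeff hq1 (hN.mono hq1 hn))
  rw [← h1.tsum_eq, ← tsum_mul_right]
  refine tsum_of_norm_bounded (hs'.mul_right ‖q ^ (J * n)‖).hasSum fun j => ?_
  rw [norm_mul, add_mul, pow_add, norm_mul, norm_pow, norm_pow, mul_assoc]
  have := pow_le_pow_of_le_one (norm_nonneg q) hq1.le (Nat.mul_le_mul_left j hn)
  gcongr

/-! ### The Borel transform on the whole plane -/

/-- The `j`-th term `d_j q^{jN} / (1 + t q^j)` of the partial fraction expansion. -/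
noncomputable def polarTerm (a b q : ℂ) (N j : ℕ) (t : ℂ) : ℂ :=
  resCoeff a b q j * q ^ (j * N) / (1 + t * q ^ j)

/-- The partial fraction expansion of the `q`-Borel transform with the first `N` coefficients
split off. For `IsLate a b q N` its value does not depend on `N` away from the poles; at the pole
`-q^{-j}` the undefined `j`-th fraction counts as `0`. -/
noncomputable def borelSum (a b q : ℂ) (N : ℕ) (t : ℂ) : ℂ :=
  ∑ n ∈ Finset.range N, lateCoeff a b q n * (-t) ^ n + (-t) ^ N * ∑' j, polarTerm a b q N j t

lemma one_add_mul_pow_eq_zero_iff {q : ℂ} (hq0 : 0 < ‖q‖) (t : ℂ) (j : ℕ) :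
    1 + t * q ^ j = 0 ↔ t = -q ^ (-(j : ℤ)) := by
  have hq : q ^ j ≠ 0 := pow_ne_zero _ (norm_pos_iff.1 hq0)
  rw [zpow_neg, zpow_natCast]
  constructor
  · intro h
    field_simp
    linear_combination h
  · rintro rfl
    field_simp
    ring

lemma pole_injective {q : ℂ} (hq0 : 0 < ‖q‖) (hq1 : ‖q‖ < 1) {i j : ℕ}
    (h : 1 + -q ^ (-(j : ℤ)) * q ^ i = 0) : i = j := by
  rw [one_add_mul_pow_eq_zero_iff hq0, neg_inj] at h
  have h2 := congrArg (fun x => ‖x‖) h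
  simp only [norm_zpow] at h2
  have := zpow_right_injective₀ hq0 hq1.ne h2
  simpa using this.symm

lemma half_le_norm_one_add {x : ℂ} (hx : ‖x‖ ≤ 1 / 2) : 1 / 2 ≤ ‖1 + x‖ := by
  have := norm_sub_le (1 + x) x
  simp only [add_sub_cancel_right, norm_one] at this
  linarith

lemma norm_polarTerm_le (a b : ℂ) {q t : ℂ} {N j : ℕ} {κ : ℝ} (hκ : 0 < κ)
    (h : κ ≤ ‖1 + t * q ^ j‖) :
    ‖polarTerm a b q N j t‖ ≤ ‖resCoeff a b q j‖ * ‖q‖ ^ (j * N) * κ⁻¹ := by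
  rw [polarTerm, norm_div, norm_mul, norm_pow, div_eq_mul_inv]
  gcongr

lemma norm_polarTerm_tail_le (a b : ℂ) {q t : ℂ} {N M : ℕ} (hq1 : ‖q‖ < 1) {R : ℝ}
    (hR : R * ‖q‖ ^ M ≤ 1 / 2) (ht : ‖t‖ ≤ R) (j : ℕ) :
    ‖polarTerm a b q N (j + M) t‖ ≤
      ‖resCoeff a b q (j + M)‖ * ‖q‖ ^ ((j + M) * N) * (1 / 2)⁻¹ := by
  refine norm_polarTerm_le a b (by norm_num) (half_le_norm_one_add ?_)
  rw [norm_mul, norm_pow]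
  have := pow_le_pow_of_le_one (norm_nonneg q) hq1.le (Nat.le_add_left M j)
  calc _ ≤ R * ‖q‖ ^ M := by gcongr; exact (norm_nonneg t).trans ht
    _ ≤ _ := hR

lemma exists_tail_index {q : ℂ} (hq1 : ‖q‖ < 1) (R : ℝ) (m : ℕ) :
    ∃ M, m ≤ M ∧ R * ‖q‖ ^ M ≤ 1 / 2 := by
  have h := (tendsto_pow_atTop_nhds_zero_of_lt_one (norm_nonneg q) hq1).const_mul R
  have h2 := h.eventually_le_const (u := 1 / 2) (by simp)
  exact ((eventually_ge_atTop m).and h2).exists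

lemma summable_polarTerm {a b q : ℂ} {N : ℕ} (hq1 : ‖q‖ < 1) (hN : IsLate a b q N) (t : ℂ) :
    Summable fun j => polarTerm a b q N j t := by
  obtain ⟨M, -, hM⟩ := exists_tail_index hq1 ‖t‖ 0
  refine (summable_nat_add_iff M).1 (.of_norm ?_)
  exact (((summable_nat_add_iff M).2 (hN.summable_norm hq1)).mul_right _).of_nonneg_of_le
    (fun _ => norm_nonneg _) (norm_polarTerm_tail_le a b hq1 hM le_rfl)

lemma analyticAt_tail {a b q : ℂ} {N M : ℕ} (hq1 : ‖q‖ < 1) (hN : IsLate a b q N) {t₀ : ℂ}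
    (hM : (‖t₀‖ + 1) * ‖q‖ ^ M ≤ 1 / 2) :
    AnalyticAt ℂ (fun t => ∑' j, polarTerm a b q N (j + M) t) t₀ := by
  have hball : Metric.ball (0 : ℂ) (‖t₀‖ + 1) ∈ 𝓝 t₀ :=
    Metric.isOpen_ball.mem_nhds (by simp)
  refine DifferentiableOn.analyticAt (s := Metric.ball (0 : ℂ) (‖t₀‖ + 1)) ?_ hball
  have hle : ∀ t ∈ Metric.ball (0 : ℂ) (‖t₀‖ + 1), ‖t‖ ≤ ‖t₀‖ + 1 := fun t ht => by
    simpa using (mem_ball_zero_iff.1 ht).le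
  refine Complex.differentiableOn_tsum_of_summable_norm
    (((summable_nat_add_iff M).2 (hN.summable_norm hq1)).mul_right (1 / 2)⁻¹) (fun j => ?_)
    Metric.isOpen_ball fun j t ht => norm_polarTerm_tail_le a b hq1 hM (hle t ht) j
  intro t ht
  refine DifferentiableAt.differentiableWithinAt ?_
  have hne : 1 + t * q ^ (j + M) ≠ 0 := by
    have : 1 / 2 ≤ ‖1 + t * q ^ (j + M)‖ := by
      refine half_le_norm_one_add ?_
      rw [norm_mul, norm_pow]
      have := pow_le_pow_of_le_one (norm_nonneg q) hq1.le (Nat.le_add_left M j)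
      refine le_trans ?_ hM
      have := hle t ht
      gcongr
    intro h
    rw [h, norm_zero] at this
    norm_num at this
  unfold polarTerm
  fun_prop (disch := exact hne)

lemma analyticAt_polarTerm (a b : ℂ) {q t₀ : ℂ} (N : ℕ) {j : ℕ} (h : 1 + t₀ * q ^ j ≠ 0) :
    AnalyticAt ℂ (polarTerm a b q N j) t₀ := by
  unfold polarTerm
  fun_prop (disch := exact h)

lemma analyticAt_borelSum {a b q : ℂ} {N : ℕ} (hq1 : ‖q‖ < 1) (hN : IsLate a b q N) {t₀ : ℂ}
    (ht : ∀ j : ℕ, 1 + t₀ * q ^ j ≠ 0) : AnalyticAt ℂ (borelSum a b q N) t₀ := by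
  obtain ⟨M, -, hM⟩ := exists_tail_index hq1 (‖t₀‖ + 1) 0
  have h1 : (fun t => ∑' j, polarTerm a b q N j t) = fun t =>
      ∑ j ∈ Finset.range M, polarTerm a b q N j t + ∑' j, polarTerm a b q N (j + M) t :=
    funext fun t => ((summable_polarTerm hq1 hN t).sum_add_tsum_nat_add M).symm
  have h2 : AnalyticAt ℂ (fun t => ∑' j, polarTerm a b q N j t) t₀ := by
    rw [h1]
    exact (Finset.analyticAt_fun_sum _ fun j _ => analyticAt_polarTerm a b N (ht j)).add
      (analyticAt_tail hq1 hN hM)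
  unfold borelSum
  exact (Finset.analyticAt_fun_sum _ fun j _ => by fun_prop).add
    (AnalyticAt.mul (by fun_prop) h2)

/-- Local behaviour of the Borel transform at its `j`-th pole. The factor `(-t q^j)^N` of the
`j`-th partial fraction differs from `1` by a multiple of `1 + t q^j`. -/
lemma borelSum_principal_part {a b q : ℂ} {N : ℕ} (hq0 : 0 < ‖q‖) (hq1 : ‖q‖ < 1)
    (hN : IsLate a b q N) (j : ℕ) :
    ∃ h : ℂ → ℂ, AnalyticAt ℂ h (-q ^ (-(j : ℤ))) ∧
      ∀ᶠ t in 𝓝[≠] (-q ^ (-(j : ℤ))),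
        borelSum a b q N t = resCoeff a b q j / (1 + t * q ^ j) + h t := by
  set t₀ := -q ^ (-(j : ℤ)) with ht₀
  obtain ⟨M, hjM, hM⟩ := exists_tail_index hq1 (‖t₀‖ + 1) (j + 1)
  refine ⟨fun t => ∑ n ∈ Finset.range N, lateCoeff a b q n * (-t) ^ n +
    (-t) ^ N * (∑ i ∈ (Finset.range M).erase j, polarTerm a b q N i t +
      ∑' i, polarTerm a b q N (i + M) t) -
    resCoeff a b q j * ∑ i ∈ Finset.range N, (-t * q ^ j) ^ i, ?_, ?_⟩
  · refine AnalyticAt.sub (AnalyticAt.add (Finset.analyticAt_fun_sum _ fun j _ => by fun_prop)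
      (AnalyticAt.mul (by fun_prop) (AnalyticAt.add (Finset.analyticAt_fun_sum _ fun i hi => ?_)
        (analyticAt_tail hq1 hN hM))))
      (AnalyticAt.mul (by fun_prop) (Finset.analyticAt_fun_sum _ fun j _ => by fun_prop))
    exact analyticAt_polarTerm a b N fun h0 =>
      (Finset.mem_erase.1 hi).1 (pole_injective hq0 hq1 h0)
  · filter_upwards [self_mem_nhdsWithin] with t ht
    have hne : 1 + t * q ^ j ≠ 0 := fun h0 => ht ((one_add_mul_pow_eq_zero_iff hq0 t j).1 h0)
    have hgeom := mul_neg_geom_sum (-t * q ^ j) N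
    have hpow : (-t * q ^ j) ^ N = (-t) ^ N * q ^ (j * N) := by rw [mul_pow, pow_mul]
    rw [borelSum, ← (summable_polarTerm hq1 hN t).sum_add_tsum_nat_add M,
      ← Finset.add_sum_erase _ _ (Finset.mem_range.2 (Nat.lt_of_succ_le hjM)), polarTerm]
    rw [hpow] at hgeom
    generalize ∑ i ∈ Finset.range N, (-t * q ^ j) ^ i = S at hgeom ⊢
    field_simp
    linear_combination (resCoeff a b q j) * hgeom

lemma meromorphicAt_borelSum {a b q : ℂ} {N : ℕ} (hq0 : 0 < ‖q‖) (hq1 : ‖q‖ < 1)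
    (hN : IsLate a b q N) (t : ℂ) : MeromorphicAt (borelSum a b q N) t := by
  by_cases ht : ∀ j : ℕ, 1 + t * q ^ j ≠ 0
  · exact (analyticAt_borelSum hq1 hN ht).meromorphicAt
  · push Not at ht
    obtain ⟨j, hj⟩ := ht
    obtain rfl := (one_add_mul_pow_eq_zero_iff hq0 t j).1 hj
    obtain ⟨h, hh, he⟩ := borelSum_principal_part hq0 hq1 hN j
    refine MeromorphicAt.congr ?_ (he.mono fun t ht => ht.symm)
    refine MeromorphicAt.add ?_ hh.meromorphicAt
    exact (MeromorphicAt.const _ _).div (AnalyticAt.meromorphicAt (by fun_prop))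

/-- A simple principal part with non-zero coefficient gives a pole of order one. -/
lemma meromorphicOrderAt_eq_neg_one {q : ℂ} (hq0 : 0 < ‖q‖) {B : ℂ → ℂ} {j : ℕ} {δ : ℂ}
    (hδ : δ ≠ 0) (hB : MeromorphicAt B (-q ^ (-(j : ℤ)))) {h : ℂ → ℂ}
    (hh : AnalyticAt ℂ h (-q ^ (-(j : ℤ))))
    (he : ∀ᶠ t in 𝓝[≠] (-q ^ (-(j : ℤ))), B t = δ / (1 + t * q ^ j) + h t) :
    meromorphicOrderAt B (-q ^ (-(j : ℤ))) = -1 := by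
  have hq : q ^ j ≠ 0 := pow_ne_zero _ (norm_pos_iff.1 hq0)
  have key := (meromorphicOrderAt_eq_int_iff (n := -1) hB).2
    ⟨fun t => δ / q ^ j + (t - -q ^ (-(j : ℤ))) * h t, by fun_prop, by simp [hδ, hq], ?_⟩
  · exact key
  filter_upwards [he, self_mem_nhdsWithin] with t ht hne
  have hne' : t - -q ^ (-(j : ℤ)) ≠ 0 := sub_ne_zero.2 hne
  have h1 : 1 + t * q ^ j = (t - -q ^ (-(j : ℤ))) * q ^ j := by
    rw [zpow_neg, zpow_natCast]; field_simp; ring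
  rw [ht, h1, zpow_neg_one, smul_eq_mul]
  field_simp

lemma borelSum_succ {a b q : ℂ} {N : ℕ} (hq1 : ‖q‖ < 1) (hN : IsLate a b q N) {t : ℂ}
    (ht : ∀ j : ℕ, 1 + t * q ^ j ≠ 0) : borelSum a b q (N + 1) t = borelSum a b q N t := by
  have h1 := (summable_polarTerm hq1 hN t).hasSum
  have h2 := (summable_polarTerm hq1 (hN.mono hq1 N.le_succ) t).hasSum.mul_left t
  have h3 := (h1.add h2).unique ((hasSum_lateCoeff hq1 hN).congr_fun fun j => by
    have := ht j
    simp only [polarTerm, Nat.succ_eq_add_one, mul_add, pow_add, mul_one]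
    field_simp)
  rw [borelSum, borelSum, Finset.sum_range_succ, pow_succ]
  linear_combination -(-t) ^ N * h3

lemma borelSum_add {a b q : ℂ} {N : ℕ} (hq1 : ‖q‖ < 1) (hN : IsLate a b q N) {t : ℂ}
    (ht : ∀ j : ℕ, 1 + t * q ^ j ≠ 0) (m : ℕ) :
    borelSum a b q (N + m) t = borelSum a b q N t := by
  induction m with
  | zero => rfl
  | succ m ih => rw [← add_assoc, borelSum_succ hq1 (hN.mono hq1 (N.le_add_right m)) ht, ih]

lemma borelSum_eq {a b q : ℂ} {N M : ℕ} (hq1 : ‖q‖ < 1) (hN : IsLate a b q N)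
    (hM : IsLate a b q M) {t : ℂ} (ht : ∀ j : ℕ, 1 + t * q ^ j ≠ 0) :
    borelSum a b q N t = borelSum a b q M t := by
  rw [← borelSum_add hq1 hN ht M, ← borelSum_add hq1 hM ht N, add_comm]

/-- In the unit disc the partial fractions expand into geometric series, and summing over the
poles first recovers the power series. -/
lemma hasSum_borelSum {a b q : ℂ} {N : ℕ} (hq1 : ‖q‖ < 1) (hN : IsLate a b q N) {t : ℂ}
    (ht : ‖t‖ < 1) : HasSum (fun n => lateCoeff a b q n * (-t) ^ n) (borelSum a b q N t) := by
  have hsum : Summable fun x : ℕ × ℕ =>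
      resCoeff a b q x.1 * q ^ (x.1 * N) * (-t * q ^ x.1) ^ x.2 := by
    have h1 := (hN.summable_norm hq1).mul_of_nonneg
      (summable_geometric_of_lt_one (norm_nonneg t) ht) (fun _ => by positivity)
      (fun _ => by positivity)
    refine .of_norm_bounded h1 fun x => ?_
    have h2 := norm_pow_le_one hq1 x.1
    rw [norm_mul, norm_mul, norm_pow, norm_pow, norm_mul, norm_neg]
    gcongr
    exact mul_le_of_le_one_right (norm_nonneg _) h2
  have hrow : ∀ j, HasSum (fun m => resCoeff a b q j * q ^ (j * N) * (-t * q ^ j) ^ m)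
      (polarTerm a b q N j t) := fun j => by
    have h1 : ‖-t * q ^ j‖ < 1 := by
      have h2 := norm_pow_le_one hq1 j
      rw [norm_mul, norm_neg]
      exact lt_of_le_of_lt (mul_le_of_le_one_right (norm_nonneg _) h2) ht
    have := (hasSum_geometric_of_norm_lt_one h1).mul_left (resCoeff a b q j * q ^ (j * N))
    simpa [polarTerm, div_eq_mul_inv] using this
  have hcol : ∀ m, HasSum (fun j => resCoeff a b q j * q ^ (j * N) * (-t * q ^ j) ^ m)
      (lateCoeff a b q (m + N) * (-t) ^ m) := fun m => by
    have h1 := hasSum_lateCoeff hq1 (hN.mono hq1 (Nat.le_add_left N m))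
    refine (h1.mul_right ((-t) ^ m)).congr_fun fun j => ?_
    rw [mul_pow, mul_add, pow_add, pow_mul q j m]; ring
  have h1 := hsum.hasSum.prod_fiberwise hrow
  have h2 := ((Equiv.prodComm ℕ ℕ).hasSum_iff.2 hsum.hasSum).prod_fiberwise hcol
  rw [← h1.tsum_eq] at h2
  refine (hasSum_nat_add_iff' N).1 ?_
  rw [borelSum, add_sub_cancel_left]
  refine (h2.mul_left ((-t) ^ N)).congr_fun fun m => ?_
  rw [pow_add]; ring

/-! ### Moving the line of integration -/

/-- Truncated integrals of a decaying holomorphic function over two horizontal lines have the same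
limiting behaviour. -/
lemma tendsto_horizontal_integral_sub {f : ℂ → ℂ} {α β : ℝ}
    (hf : DifferentiableOn ℂ f {z | z.im ∈ Set.uIcc α β}) {e : ℝ → ℝ}
    (htop : Tendsto e atTop (𝓝 0)) (hbot : Tendsto e atBot (𝓝 0))
    (he : ∀ x : ℝ, 1 ≤ |x| → ∀ y ∈ Set.uIcc α β, ‖f (x + y * Complex.I)‖ ≤ e x) :
    Tendsto (fun R : ℝ => (∫ x in (-R)..R, f (x + α * Complex.I)) -
      ∫ x in (-R)..R, f (x + β * Complex.I)) atTop (𝓝 0) := by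
  have hlim : Tendsto (fun R : ℝ => e (-R) * |β - α| + e R * |β - α|) atTop (𝓝 0) := by
    simpa using ((hbot.comp tendsto_neg_atTop_atBot).mul_const |β - α|).add
      (htop.mul_const |β - α|)
  refine squeeze_zero_norm' ?_ hlim
  filter_upwards [eventually_ge_atTop 1] with R hR
  have h := Complex.integral_boundary_rect_eq_zero_of_differentiableOn f
    (⟨-R, α⟩ : ℂ) (⟨R, β⟩ : ℂ) (hf.mono fun z hz => hz.2)
  simp only [smul_eq_mul] at h
  have h1 : ‖∫ y in α..β, f (((-R : ℝ) : ℂ) + y * Complex.I)‖ ≤ e (-R) * |β - α| :=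
    intervalIntegral.norm_integral_le_of_norm_le_const fun y hy =>
      he (-R) (by rw [abs_neg]; exact hR.trans (le_abs_self R)) y (Set.uIoc_subset_uIcc hy)
  have h2 : ‖∫ y in α..β, f ((R : ℂ) + y * Complex.I)‖ ≤ e R * |β - α| :=
    intervalIntegral.norm_integral_le_of_norm_le_const fun y hy =>
      he R (hR.trans (le_abs_self R)) y (Set.uIoc_subset_uIcc hy)
  have h3 : (∫ x in (-R)..R, f (x + α * Complex.I)) - ∫ x in (-R)..R, f (x + β * Complex.I) =
      Complex.I * (∫ y in α..β, f (((-R : ℝ) : ℂ) + y * Complex.I)) -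
        Complex.I * ∫ y in α..β, f ((R : ℂ) + y * Complex.I) := by
    linear_combination h
  rw [h3]
  refine (norm_sub_le _ _).trans ?_
  simp only [norm_mul, Complex.norm_I, one_mul]
  exact add_le_add h1 h2

lemma tendsto_symm_intervalIntegral {f : ℝ → ℂ} (hf : Integrable f) :
    Tendsto (fun R : ℝ => ∫ x in (-R)..R, f x) atTop (𝓝 (∫ x, f x)) :=
  intervalIntegral_tendsto_integral hf tendsto_neg_atTop_atBot tendsto_id

/-- Cauchy's theorem for a horizontal strip. -/
lemma integral_horizontal_eq {f : ℂ → ℂ} {α β : ℝ}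
    (hf : DifferentiableOn ℂ f {z | z.im ∈ Set.uIcc α β}) {e : ℝ → ℝ}
    (htop : Tendsto e atTop (𝓝 0)) (hbot : Tendsto e atBot (𝓝 0))
    (he : ∀ x : ℝ, 1 ≤ |x| → ∀ y ∈ Set.uIcc α β, ‖f (x + y * Complex.I)‖ ≤ e x)
    (hα : Integrable fun x : ℝ => f (x + α * Complex.I))
    (hβ : Integrable fun x : ℝ => f (x + β * Complex.I)) :
    ∫ x : ℝ, f (x + α * Complex.I) = ∫ x : ℝ, f (x + β * Complex.I) :=
  sub_eq_zero.1 <| tendsto_nhds_unique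
    ((tendsto_symm_intervalIntegral hα).sub (tendsto_symm_intervalIntegral hβ))
    (tendsto_horizontal_integral_sub hf htop hbot he)

lemma inv_sq_add_pi_sq (x : ℝ) :
    (x ^ 2 + Real.pi ^ 2)⁻¹ = (Real.pi ^ 2)⁻¹ * (1 + (x / Real.pi) ^ 2)⁻¹ := by
  have := Real.pi_pos
  rw [← mul_inv]; congr 1; field_simp; ring

lemma integrable_inv_sq_add_pi_sq : Integrable fun x : ℝ => (x ^ 2 + Real.pi ^ 2)⁻¹ := by
  simp only [inv_sq_add_pi_sq]
  exact (integrable_inv_one_add_sq.comp_div Real.pi_ne_zero).const_mul _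

lemma integral_inv_sq_add_pi_sq : ∫ x : ℝ, (x ^ 2 + Real.pi ^ 2)⁻¹ = 1 := by
  simp only [inv_sq_add_pi_sq]
  rw [integral_const_mul, Measure.integral_comp_div (fun x : ℝ => (1 + x ^ 2)⁻¹),
    integral_univ_inv_one_add_sq, abs_of_pos Real.pi_pos, smul_eq_mul]
  have := Real.pi_pos
  field_simp

lemma dslope_exp_ne_zero {u : ℂ} (hu : |u.im| < 2 * Real.pi) :
    dslope Complex.exp 0 u ≠ 0 := by
  by_cases h0 : u = 0
  · subst h0; simp [dslope_same]
  rw [dslope_of_ne _ h0, slope_def_field, Complex.exp_zero, sub_zero]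
  refine div_ne_zero (fun h => h0 ?_) h0
  obtain ⟨n, hn⟩ := Complex.exp_eq_one_iff.1 (sub_eq_zero.1 h)
  have him : u.im = n * (2 * Real.pi) := by rw [hn]; simp
  rw [him, abs_mul, abs_of_pos Real.two_pi_pos] at hu
  have hn0 : |(n : ℝ)| < 1 := by
    have := Real.two_pi_pos
    by_contra hc
    nlinarith
  have : n = 0 := by
    have h1 : |n| < 1 := by exact_mod_cast hn0
    exact Int.abs_lt_one_iff.1 h1
  rw [hn, this]; simp

lemma exp_add_pi_mul_I (x : ℂ) : Complex.exp (x + Real.pi * Complex.I) = -Complex.exp x := by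
  rw [Complex.exp_add, Complex.exp_pi_mul_I]; ring

lemma exp_sub_pi_mul_I (x : ℂ) : Complex.exp (x - Real.pi * Complex.I) = -Complex.exp x := by
  rw [Complex.exp_sub, Complex.exp_pi_mul_I]; ring

lemma half_le_norm_exp_sub_one {u : ℂ} (hu : 1 ≤ |u.re|) : 1 / 2 ≤ ‖Complex.exp u - 1‖ := by
  have h1 := abs_norm_sub_norm_le (Complex.exp u) 1
  rw [Complex.norm_exp, norm_one] at h1
  refine le_trans ?_ h1
  rcases le_abs.1 hu with h | h
  · refine le_trans ?_ (le_abs_self _)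
    have := Real.add_one_le_exp u.re
    linarith
  · refine le_trans ?_ (neg_le_abs _)
    have h2 := Real.add_one_le_exp (-u.re)
    have h3 : Real.exp u.re * Real.exp (-u.re) = 1 := by rw [← Real.exp_add]; simp
    nlinarith [Real.exp_pos u.re]

/-- The residue theorem on the strip `|Im u| ≤ π` for `h(u) / (1 - e^u)`, whose only pole there is
at `0`. The pole is removed by subtracting a multiple of `1/u`, whose contribution is the
integral of `1 / (x² + π²)`. -/
lemma integral_residue_strip {h : ℂ → ℂ} (hh : Differentiable ℂ h) {e : ℝ → ℝ}
    (htop : Tendsto e atTop (𝓝 0)) (hbot : Tendsto e atBot (𝓝 0))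
    (he : ∀ x y : ℝ, |y| ≤ Real.pi → ‖h (x + y * Complex.I)‖ ≤ e x)
    (hp : Integrable fun x : ℝ => h (x + Real.pi * Complex.I) / (1 + Complex.exp x))
    (hm : Integrable fun x : ℝ => h (x - Real.pi * Complex.I) / (1 + Complex.exp x)) :
    (∫ x : ℝ, h (x + Real.pi * Complex.I) / (1 + Complex.exp x)) -
      ∫ x : ℝ, h (x - Real.pi * Complex.I) / (1 + Complex.exp x) =
      2 * Real.pi * Complex.I * h 0 := by
  have hπ := Real.pi_pos
  set S : Set ℂ := {z | |z.im| < 2 * Real.pi} with hS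
  have hSo : IsOpen S := isOpen_lt (by fun_prop) continuous_const
  have h0S : S ∈ 𝓝 (0 : ℂ) := hSo.mem_nhds (by simp [hS, hπ])
  set H : ℂ → ℂ := fun u => h u / dslope Complex.exp 0 u with hH
  have hHd : DifferentiableOn ℂ H S := by
    refine hh.differentiableOn.div ?_ fun u hu => dslope_exp_ne_zero hu
    exact (Complex.differentiableOn_dslope h0S).2 Complex.differentiable_exp.differentiableOn
  have hgd : DifferentiableOn ℂ (dslope H 0) S := (Complex.differentiableOn_dslope h0S).2 hHd
  have hH0 : H 0 = h 0 := by simp [hH, dslope_same]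
  -- With `H u = h u * u / (e^u - 1)`, the slope `(H u - H 0) / u` is the integrand minus its pole.
  have hg : ∀ u : ℂ, u ≠ 0 → dslope H 0 u = h u / (Complex.exp u - 1) - h 0 / u := by
    intro u hu
    rw [dslope_of_ne _ hu, slope_def_field, hH0, hH, sub_zero]
    simp only
    rw [dslope_of_ne _ hu, slope_def_field, Complex.exp_zero, sub_zero, sub_div]
    congr 1
    rw [div_div_eq_mul_div, div_right_comm, mul_div_cancel_right₀ _ hu]
  have hinv : Tendsto (fun x : ℝ => ‖h 0‖ * |x|⁻¹) atTop (𝓝 0) := by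
    simpa using (tendsto_inv_atTop_zero.comp tendsto_abs_atTop_atTop).const_mul ‖h 0‖
  have hinv' : Tendsto (fun x : ℝ => ‖h 0‖ * |x|⁻¹) atBot (𝓝 0) := by
    simpa using (tendsto_inv_atTop_zero.comp tendsto_abs_atBot_atTop).const_mul ‖h 0‖
  have hIcc : ∀ y ∈ Set.uIcc (-Real.pi) Real.pi, |y| ≤ Real.pi := fun y hy => by
    rw [Set.uIcc_of_le (by linarith)] at hy
    exact abs_le.2 hy
  have key := tendsto_horizontal_integral_sub (f := dslope H 0) (α := -Real.pi) (β := Real.pi)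
    (e := fun x => e x * 2 + ‖h 0‖ * |x|⁻¹)
    (hgd.mono fun z hz => lt_of_le_of_lt (hIcc _ hz) (by linarith))
    (by simpa using (htop.mul_const 2).add hinv) (by simpa using (hbot.mul_const 2).add hinv')
    (fun x hx y hy => by
      have hre : ((x : ℂ) + y * Complex.I).re = x := by simp
      have hne : (x : ℂ) + y * Complex.I ≠ 0 := fun h0 => by
        rw [h0] at hre
        rw [← hre] at hx
        norm_num at hx
      rw [hg _ hne]
      refine (norm_sub_le _ _).trans (add_le_add ?_ ?_)
      · rw [norm_div, div_eq_mul_inv]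
        have h1 := half_le_norm_exp_sub_one (u := x + y * Complex.I) (by rwa [hre])
        have h2 : ‖Complex.exp (x + y * Complex.I) - 1‖⁻¹ ≤ 2 := by
          rw [inv_le_comm₀ (by linarith) two_pos]; linarith
        have h3 := he x y (hIcc y hy)
        gcongr
        exact (norm_nonneg _).trans h3
      · rw [norm_div, div_eq_mul_inv]
        have h1 := Complex.abs_re_le_norm (x + y * Complex.I)
        rw [hre] at h1
        gcongr)
  have hsq : ∀ x : ℝ, (x : ℂ) ^ 2 + Real.pi ^ 2 ≠ 0 := fun x => by
    exact_mod_cast (by positivity : x ^ 2 + Real.pi ^ 2 ≠ 0)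
  have hfac : ∀ x : ℝ, (x : ℂ) ^ 2 + Real.pi ^ 2 =
      (x + Real.pi * Complex.I) * (x - Real.pi * Complex.I) := fun x => by
    linear_combination ((Real.pi : ℂ) ^ 2) * Complex.I_sq
  have hne1 : ∀ x : ℝ, (x : ℂ) + Real.pi * Complex.I ≠ 0 := fun x h0 => hsq x (by
    rw [hfac, h0, zero_mul])
  have hne2 : ∀ x : ℝ, (x : ℂ) - Real.pi * Complex.I ≠ 0 := fun x h0 => hsq x (by
    rw [hfac, h0, mul_zero])
  have hpt : ∀ x : ℝ, dslope H 0 (x + (-Real.pi : ℝ) * Complex.I) -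
      dslope H 0 (x + Real.pi * Complex.I) =
      (h (x + Real.pi * Complex.I) / (1 + Complex.exp x) -
        h (x - Real.pi * Complex.I) / (1 + Complex.exp x)) -
        2 * Real.pi * Complex.I * h 0 * (((x ^ 2 + Real.pi ^ 2)⁻¹ : ℝ) : ℂ) := fun x => by
    have e1 : (x : ℂ) + (-Real.pi : ℝ) * Complex.I = x - Real.pi * Complex.I := by
      push_cast; ring
    rw [e1, hg _ (hne1 x), hg _ (hne2 x), exp_add_pi_mul_I, exp_sub_pi_mul_I]
    have e2 : -Complex.exp x - 1 = -(1 + Complex.exp x) := by ring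
    push_cast
    rw [e2, hfac, div_neg, div_neg]
    have := hne1 x
    have := hne2 x
    field_simp
    ring
  have hI : Integrable fun x : ℝ =>
      2 * Real.pi * Complex.I * h 0 * (((x ^ 2 + Real.pi ^ 2)⁻¹ : ℝ) : ℂ) :=
    integrable_inv_sq_add_pi_sq.ofReal.const_mul _
  have hint : Integrable fun x : ℝ => (h (x + Real.pi * Complex.I) / (1 + Complex.exp x) -
        h (x - Real.pi * Complex.I) / (1 + Complex.exp x)) -
        2 * Real.pi * Complex.I * h 0 * (((x ^ 2 + Real.pi ^ 2)⁻¹ : ℝ) : ℂ) :=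
    (hp.sub hm).sub hI
  have hcont : ∀ y : ℝ, |y| < 2 * Real.pi →
      Continuous fun x : ℝ => dslope H 0 (x + y * Complex.I) := fun y hy =>
    hgd.continuousOn.comp_continuous (by fun_prop) fun x => by simpa [hS] using hy
  have hlim := tendsto_symm_intervalIntegral hint
  have hfin := tendsto_nhds_unique (hlim.congr fun R => by
    rw [← intervalIntegral.integral_sub
      ((hcont (-Real.pi) (by rw [abs_neg, abs_of_pos hπ]; linarith)).intervalIntegrable _ _)
      ((hcont Real.pi (by rw [abs_of_pos hπ]; linarith)).intervalIntegrable _ _)]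
    exact intervalIntegral.integral_congr fun x _ => (hpt x).symm) key
  rw [integral_sub (f := fun x : ℝ => h (x + Real.pi * Complex.I) / (1 + Complex.exp x) -
    h (x - Real.pi * Complex.I) / (1 + Complex.exp x)) (hp.sub hm) hI,
    integral_sub hp hm, integral_const_mul, integral_complex_ofReal, integral_inv_sq_add_pi_sq] at hfin
  push_cast at hfin
  linear_combination hfin

/-! ### Gaussian integrals -/

/-- The function `e^{νu} E_q(e^{u-l})` of `u`, an exponential of a quadratic polynomial. In the
variable `t = e^u` it is `t^ν E_q(t/z)`, where `z = e^l`. -/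
noncomputable def expGauss (p : ℝ) (ν l u : ℂ) : ℂ := Complex.exp (ν * u) * gaussE p (u - l)

lemma ofReal_log_ne_zero {p : ℝ} (hp0 : 0 < p) (hp1 : p < 1) : (Real.log p : ℂ) ≠ 0 := by
  exact_mod_cast (Real.log_neg hp0 hp1).ne

lemma differentiable_gaussE (p : ℝ) : Differentiable ℂ (gaussE p) := by
  unfold gaussE; fun_prop

lemma differentiable_expGauss (p : ℝ) (ν l : ℂ) : Differentiable ℂ (expGauss p ν l) := by
  unfold expGauss gaussE; fun_prop

lemma expGauss_add (p : ℝ) (ν l u v : ℂ) :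
    expGauss p ν l (u + v) = Complex.exp (ν * v) * expGauss p ν (l - v) u := by
  rw [expGauss, expGauss, mul_add, Complex.exp_add, show u + v - l = u - (l - v) by ring]
  ring

lemma expGauss_eq_quadratic {p : ℝ} (hp0 : 0 < p) (hp1 : p < 1) (ν l u : ℂ) :
    expGauss p ν l u = Complex.exp ((2 * (Real.log p : ℂ))⁻¹ * u ^ 2 +
      (ν - (l + Real.log p / 2) / Real.log p) * u +
        (l + Real.log p / 2) ^ 2 / (2 * Real.log p)) := by
  have hL := ofReal_log_ne_zero hp0 hp1
  rw [expGauss, gaussE, ← Complex.exp_add]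
  congr 1
  field_simp
  ring

lemma quadratic_re_neg {p : ℝ} (hp0 : 0 < p) (hp1 : p < 1) :
    ((2 * (Real.log p : ℂ))⁻¹).re < 0 := by
  have h : (2 * (Real.log p : ℂ))⁻¹ = (((2 * Real.log p)⁻¹ : ℝ) : ℂ) := by push_cast; rfl
  rw [h, Complex.ofReal_re, inv_lt_zero]
  linarith [Real.log_neg hp0 hp1]

lemma integrable_expGauss {p : ℝ} (hp0 : 0 < p) (hp1 : p < 1) (ν l : ℂ) :
    Integrable fun x : ℝ => expGauss p ν l x := by
  simp only [expGauss_eq_quadratic hp0 hp1]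
  exact integrable_cexp_quadratic' (quadratic_re_neg hp0 hp1) _ _

lemma lapConst_pos {p : ℝ} (hp0 : 0 < p) (hp1 : p < 1) : 0 < lapConst p := by
  have := Real.log_neg hp0 hp1
  have := Real.pi_pos
  unfold lapConst
  have : 0 < -(2 * Real.pi * Real.log p) := by nlinarith
  positivity

/-- The moments of the `q`-Laplace kernel: `C_q ∫_0^∞ t^ν E_q(t/z) dt/t = z^ν q^{-ν(ν-1)/2}`. -/
lemma lapConst_mul_integral_expGauss {p : ℝ} (hp0 : 0 < p) (hp1 : p < 1) (ν l : ℂ) :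
    (lapConst p : ℂ) * ∫ x : ℝ, expGauss p ν l x =
      Complex.exp (ν * l - Real.log p * (ν * (ν - 1) / 2)) := by
  have hL := ofReal_log_ne_zero hp0 hp1
  have hlog := Real.log_neg hp0 hp1
  have hpos : 0 < -(2 * Real.pi * Real.log p) := by nlinarith [Real.pi_pos]
  simp only [expGauss_eq_quadratic hp0 hp1]
  rw [integral_cexp_quadratic (quadratic_re_neg hp0 hp1)]
  have h1 : (Real.pi : ℂ) / -(2 * (Real.log p : ℂ))⁻¹ =
      ((-(2 * Real.pi * Real.log p) : ℝ) : ℂ) := by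
    push_cast; field_simp
  have h2 : ((-(2 * Real.pi * Real.log p) : ℝ) : ℂ) ^ (1 / 2 : ℂ) =
      (Real.sqrt (-(2 * Real.pi * Real.log p)) : ℂ) := by
    rw [Real.sqrt_eq_rpow, Complex.ofReal_cpow hpos.le]; norm_num
  have h3 : (Real.sqrt (-(2 * Real.pi * Real.log p)) : ℂ) ≠ 0 := by
    exact_mod_cast (Real.sqrt_pos.2 hpos).ne'
  rw [h1, h2, lapConst, ← mul_assoc]
  rw [show ((1 / Real.sqrt (-(2 * Real.pi * Real.log p)) : ℝ) : ℂ) *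
    (Real.sqrt (-(2 * Real.pi * Real.log p)) : ℂ) = 1 by push_cast; field_simp, one_mul]
  congr 1
  field_simp
  ring

lemma norm_gaussE (p : ℝ) (l : ℂ) :
    ‖gaussE p l‖ = Real.exp (((l.re - Real.log p / 2) ^ 2 - l.im ^ 2) / (2 * Real.log p)) := by
  rw [gaussE, Complex.norm_exp]
  congr 1
  have h : (l - (Real.log p : ℂ) / 2) ^ 2 / (2 * (Real.log p : ℂ)) =
      (l - (Real.log p : ℂ) / 2) ^ 2 / ((2 * Real.log p : ℝ) : ℂ) := by push_cast; rfl
  have hre : (l - (Real.log p : ℂ) / 2).re = l.re - Real.log p / 2 := by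
    simp
  have him : (l - (Real.log p : ℂ) / 2).im = l.im := by
    simp
  rw [h, Complex.div_ofReal_re, sq, Complex.mul_re, hre, him]
  ring

lemma norm_expGauss (p N : ℝ) (l : ℂ) (x y : ℝ) :
    ‖expGauss p N l (x + y * Complex.I)‖ =
      ‖expGauss p N l.re x‖ * Real.exp (-(y - l.im) ^ 2 / (2 * Real.log p)) := by
  simp only [expGauss, norm_mul, norm_gaussE, Complex.norm_exp, ← Real.exp_add]
  congr 1
  simp
  ring

lemma norm_expGauss_ofReal (p N : ℝ) (l : ℂ) (x : ℝ) :
    ‖expGauss p N l x‖ = ‖expGauss p N l.re x‖ * Real.exp (-l.im ^ 2 / (2 * Real.log p)) := by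
  simpa using norm_expGauss p N l x 0

lemma expGauss_ofReal (p N x₀ x : ℝ) : expGauss p N x₀ x = (‖expGauss p N x₀ x‖ : ℂ) := by
  have h : expGauss p N x₀ x = ((Real.exp (N * x) *
      Real.exp ((x - x₀ - Real.log p / 2) ^ 2 / (2 * Real.log p)) : ℝ) : ℂ) := by
    rw [expGauss, gaussE]; push_cast; rfl
  rw [h, Complex.norm_real, Real.norm_of_nonneg (by positivity)]

lemma lapConst_mul_integral_norm_expGauss {p : ℝ} (hp0 : 0 < p) (hp1 : p < 1) (N : ℝ) (l : ℂ) :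
    lapConst p * ∫ x : ℝ, ‖expGauss p N l x‖ =
      Real.exp (N * l.re - Real.log p * (N * (N - 1) / 2)) *
        Real.exp (-l.im ^ 2 / (2 * Real.log p)) := by
  simp only [norm_expGauss_ofReal p N l]
  rw [integral_mul_const, ← mul_assoc]
  congr 1
  have h := lapConst_mul_integral_expGauss hp0 hp1 N l.re
  rw [integral_congr_ae (ae_of_all _ fun x => expGauss_ofReal p N l.re x),
    integral_complex_ofReal] at h
  exact_mod_cast h

lemma norm_expGauss_re (p N x₀ x : ℝ) : ‖expGauss p N x₀ x‖ =
    Real.exp (N * x + (x - x₀ - Real.log p / 2) ^ 2 / (2 * Real.log p)) := by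
  simp only [expGauss, norm_mul, norm_gaussE, Complex.norm_exp, ← Real.exp_add]
  congr 1
  simp

lemma tendsto_norm_expGauss {p : ℝ} (hp0 : 0 < p) (hp1 : p < 1) (N x₀ : ℝ) :
    Tendsto (fun x : ℝ => ‖expGauss p N x₀ x‖) atTop (𝓝 0) ∧
      Tendsto (fun x : ℝ => ‖expGauss p N x₀ x‖) atBot (𝓝 0) := by
  have hlog := Real.log_neg hp0 hp1
  have hinv : (2 * Real.log p)⁻¹ < 0 := inv_lt_zero.2 (by linarith)
  set c := N - (x₀ + Real.log p / 2) / Real.log p with hc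
  have hq : ∀ x : ℝ, N * x + (x - x₀ - Real.log p / 2) ^ 2 / (2 * Real.log p) =
      x * ((2 * Real.log p)⁻¹ * x + c) + (x₀ + Real.log p / 2) ^ 2 / (2 * Real.log p) := fun x => by
    have := hlog.ne
    rw [hc]
    field_simp
    ring
  simp only [norm_expGauss_re, hq]
  refine ⟨Real.tendsto_exp_atBot.comp (tendsto_atBot_add_const_right _ _ ?_),
    Real.tendsto_exp_atBot.comp (tendsto_atBot_add_const_right _ _ ?_)⟩
  · exact tendsto_id.atTop_mul_atBot₀
      (tendsto_atBot_add_const_right _ _ (tendsto_id.const_mul_atTop_of_neg hinv))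
  · exact tendsto_id.atBot_mul_atTop₀
      (tendsto_atTop_add_const_right _ _ (tendsto_id.const_mul_atBot_of_neg hinv))

/-! ### The hyperterminant integrals -/

/-- The integrand `e^{Nu} E_q(e^{u-l}) / (1 + r e^u)`; in the variable `t = e^u` it is
`t^N E_q(t/z) / (1 + rt)`, where `z = e^l`. -/
noncomputable def poleKernel (p : ℝ) (N : ℕ) (r : ℝ) (l u : ℂ) : ℂ :=
  expGauss p (N : ℝ) l u / (1 + r * Complex.exp u)

/-- The integral `∫_0^∞ t^N E_q(t/z) / (1 + rt) dt/t` in logarithmic coordinates. -/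
noncomputable def poleIntegral (p : ℝ) (N : ℕ) (r : ℝ) (l : ℂ) : ℂ :=
  ∫ x : ℝ, poleKernel p N r l x

/-- The denominator stays away from `0` on rays off the negative axis. -/
lemma cos_half_le_norm_one_add {r : ℝ} (hr : 0 < r) (x y : ℝ) :
    Real.cos (y / 2) ≤ ‖1 + r * Complex.exp (x + y * Complex.I)‖ := by
  refine le_of_abs_le (abs_le_of_sq_le_sq ?_ (norm_nonneg _))
  set ρ := r * Real.exp x with hρ
  have hρ0 : 0 < ρ := by positivity
  have h1 : 1 + r * Complex.exp (x + y * Complex.I) =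
      ((1 + ρ * Real.cos y : ℝ) : ℂ) + (ρ * Real.sin y : ℝ) * Complex.I := by
    rw [Complex.exp_add, Complex.exp_mul_I]; push_cast [hρ]; ring
  rw [h1, Complex.sq_norm, Complex.normSq_add_mul_I]
  have h2 : Real.cos y = 2 * Real.cos (y / 2) ^ 2 - 1 := by rw [← Real.cos_two_mul]; ring_nf
  have h3 := Real.sin_sq_add_cos_sq y
  have h4 := Real.cos_sq_le_one (y / 2)
  have h5 : (1 + ρ * Real.cos y) ^ 2 + (ρ * Real.sin y) ^ 2 = 1 + 2 * ρ * Real.cos y + ρ ^ 2 := by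
    linear_combination ρ ^ 2 * h3
  rw [h5, h2]
  nlinarith [mul_nonneg (sq_nonneg (1 - ρ)) (sub_nonneg.2 h4),
    mul_nonneg (by positivity : 0 ≤ ρ * (2 + ρ)) (sq_nonneg (Real.cos (y / 2)))]

lemma cos_half_pos {y : ℝ} (hy : |y| < Real.pi) : 0 < Real.cos (y / 2) := by
  have := abs_lt.1 hy
  exact Real.cos_pos_of_mem_Ioo ⟨by linarith, by linarith⟩

lemma one_add_mul_exp_ne_zero {r : ℝ} (hr : 0 < r) {u : ℂ} (hu : |u.im| < Real.pi) :
    1 + r * Complex.exp u ≠ 0 := by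
  have h := cos_half_le_norm_one_add hr u.re u.im
  rw [Complex.re_add_im] at h
  exact norm_pos_iff.1 ((cos_half_pos hu).trans_le h)

lemma norm_poleKernel_le {r : ℝ} (hr : 0 < r) (p : ℝ) (N : ℕ) (l : ℂ) (x : ℝ) {y : ℝ}
    (hy : |y| < Real.pi) :
    ‖poleKernel p N r l (x + y * Complex.I)‖ ≤
      ‖expGauss p (N : ℝ) l (x + y * Complex.I)‖ * (Real.cos (y / 2))⁻¹ := by
  rw [poleKernel, norm_div, div_eq_mul_inv]
  have := cos_half_le_norm_one_add hr x y
  have := cos_half_pos hy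
  gcongr

lemma norm_poleKernel_ofReal_le {r : ℝ} (hr : 0 < r) (p : ℝ) (N : ℕ) (l : ℂ) (x : ℝ) :
    ‖poleKernel p N r l x‖ ≤ ‖expGauss p (N : ℝ) l x‖ := by
  simpa using norm_poleKernel_le hr p N l x (y := 0) (by simpa using Real.pi_pos)

lemma differentiableAt_poleKernel {r : ℝ} (p : ℝ) (N : ℕ) (l : ℂ) {u : ℂ}
    (hu : 1 + r * Complex.exp u ≠ 0) : DifferentiableAt ℂ (poleKernel p N r l) u := by
  unfold poleKernel
  exact (differentiable_expGauss p _ l u).div (by fun_prop) hu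

lemma integrable_poleKernel_line {p : ℝ} (hp0 : 0 < p) (hp1 : p < 1) (N : ℕ) {r : ℝ} (hr : 0 < r)
    (l v : ℂ) (hv : |v.im| < Real.pi) : Integrable fun x : ℝ => poleKernel p N r l (x + v) := by
  have hexp : Integrable fun x : ℝ => expGauss p (N : ℝ) l (x + v) := by
    simp only [expGauss_add]
    exact (integrable_expGauss hp0 hp1 _ _).const_mul _
  refine (hexp.norm.mul_const (Real.cos (v.im / 2))⁻¹).mono' ?_ (ae_of_all _ fun x => ?_)
  · refine Continuous.aestronglyMeasurable (continuous_iff_continuousAt.2 fun x => ?_)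
    have hne := one_add_mul_exp_ne_zero hr (u := x + v) (by simpa using hv)
    exact ContinuousAt.comp (f := fun x : ℝ => (x : ℂ) + v)
      (differentiableAt_poleKernel p N l hne).continuousAt (by fun_prop)
  · have h := norm_poleKernel_le hr p N l (x + v.re) hv
    have e : ((x + v.re : ℝ) : ℂ) + v.im * Complex.I = x + v := by
      conv_rhs => rw [← Complex.re_add_im v]
      push_cast; ring
    rwa [e] at h

lemma integrable_poleKernel {p : ℝ} (hp0 : 0 < p) (hp1 : p < 1) (N : ℕ) {r : ℝ} (hr : 0 < r)
    (l : ℂ) : Integrable fun x : ℝ => poleKernel p N r l x := by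
  simpa using integrable_poleKernel_line hp0 hp1 N hr l 0 (by simpa using Real.pi_pos)

/-- On a bounded horizontal strip `e^{Nu} E_q(e^{u-l})` decays uniformly as `|Re u| → ∞`. -/
lemma norm_expGauss_strip_le {p : ℝ} (hp0 : 0 < p) (hp1 : p < 1) (N : ℝ) (l : ℂ) {Y : ℝ}
    (x : ℝ) {y : ℝ} (hy : |y - l.im| ≤ Y) :
    ‖expGauss p N l (x + y * Complex.I)‖ ≤
      ‖expGauss p N l.re x‖ * Real.exp (-Y ^ 2 / (2 * Real.log p)) := by
  rw [norm_expGauss]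
  have hlog := Real.log_neg hp0 hp1
  have h2 : (y - l.im) ^ 2 ≤ Y ^ 2 := sq_le_sq' (by linarith [abs_le.1 hy]) (abs_le.1 hy).2
  gcongr ?_ * Real.exp ?_
  rw [div_le_div_right_of_neg (by linarith)]
  linarith

/-- Rotating the path of integration: shifting the line by `v` does not change the integral as
long as no pole is crossed. -/
lemma integral_poleKernel_add {p : ℝ} (hp0 : 0 < p) (hp1 : p < 1) (N : ℕ) {r : ℝ} (hr : 0 < r)
    (l v : ℂ) (hv : |v.im| < Real.pi) :
    ∫ x : ℝ, poleKernel p N r l (x + v) = poleIntegral p N r l := by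
  have h1 : ∀ x : ℝ, poleKernel p N r l (x + v) =
      (fun x : ℝ => poleKernel p N r l (x + v.im * Complex.I)) (x + v.re) := fun x => by
    simp only
    congr 1
    conv_lhs => rw [← Complex.re_add_im v]
    push_cast; ring
  simp only [h1]
  rw [integral_add_right_eq_self (fun x : ℝ => poleKernel p N r l (x + v.im * Complex.I))]
  have hstrip : ∀ y ∈ Set.uIcc v.im 0, |y| ≤ |v.im| := fun y hy => by
    rcases Set.mem_uIcc.1 hy with h | h
    · rw [abs_of_nonpos h.2, abs_of_nonpos (h.1.trans h.2)]; linarith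
    · rw [abs_of_nonneg h.1, abs_of_nonneg (h.1.trans h.2)]; linarith
  have hlim := tendsto_norm_expGauss hp0 hp1 N l.re
  set C := Real.exp (-(|v.im| + |l.im|) ^ 2 / (2 * Real.log p)) * (Real.cos (|v.im| / 2))⁻¹
    with hC
  have key := integral_horizontal_eq (f := poleKernel p N r l) (α := v.im) (β := 0)
    (e := fun x => ‖expGauss p (N : ℝ) l.re x‖ * C)
    (fun u hu => (differentiableAt_poleKernel p N l (one_add_mul_exp_ne_zero hr
      ((hstrip _ hu).trans_lt hv))).differentiableWithinAt)
    (by simpa using hlim.1.mul_const C) (by simpa using hlim.2.mul_const C)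
    (fun x _ y hy => by
      have hy' := hstrip y hy
      have hyπ : |y| < Real.pi := hy'.trans_lt hv
      have h2 : Real.cos (|v.im| / 2) ≤ Real.cos (y / 2) := by
        rw [← Real.cos_abs (y / 2), abs_div, abs_two]
        exact Real.cos_le_cos_of_nonneg_of_le_pi (by positivity) (by linarith [Real.pi_pos])
          (by linarith)
      have h3 : 0 < Real.cos (|v.im| / 2) := cos_half_pos (by rwa [abs_abs])
      refine (norm_poleKernel_le hr p N l x hyπ).trans ?_
      have h4 := norm_expGauss_strip_le hp0 hp1 N l x (y := y) (Y := |v.im| + |l.im|)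
        ((abs_sub _ _).trans (by linarith))
      rw [hC, ← mul_assoc]
      gcongr
      exact (inv_pos.2 (h3.trans_le h2)).le)
    (by simpa using integrable_poleKernel_line hp0 hp1 N hr l (v.im * Complex.I) (by simpa))
    (by simpa using integrable_poleKernel hp0 hp1 N hr l)
  rw [key]
  simp [poleIntegral]

/-- The change in `poleIntegral` around the origin is the residue at the pole `u = iπ - ln r`. -/
lemma poleIntegral_sub {p : ℝ} (hp0 : 0 < p) (hp1 : p < 1) (N : ℕ) {r : ℝ} (hr : 0 < r)
    (l : ℂ) :
    poleIntegral p N r (l - 2 * Real.pi * Complex.I) - poleIntegral p N r l =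
      2 * Real.pi * Complex.I * expGauss p (N : ℝ) l (Real.pi * Complex.I - Real.log r) := by
  have hlogr : Complex.exp (Real.log r) = r := by rw [← Complex.ofReal_exp, Real.exp_log hr]
  have hr' : (r : ℂ) ≠ 0 := by exact_mod_cast hr.ne'
  set s₀ : ℂ := Real.pi * Complex.I - Real.log r with hs₀
  set h : ℂ → ℂ := fun u => expGauss p (N : ℝ) l (u + s₀) with hh
  have hexp : ∀ x : ℝ, (r : ℂ) * Complex.exp ((x - Real.log r : ℝ) : ℂ) = Complex.exp x :=
    fun x => by
      push_cast
      rw [Complex.exp_sub, hlogr]; field_simp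
  have hminus : ∀ x : ℝ, h (x - Real.pi * Complex.I) / (1 + Complex.exp x) =
      (fun x : ℝ => poleKernel p N r l x) (x - Real.log r) := fun x => by
    simp only [hh, poleKernel, hexp]
    congr 2
    rw [hs₀]; push_cast; ring
  have hplus : ∀ x : ℝ, h (x + Real.pi * Complex.I) / (1 + Complex.exp x) =
      (fun x : ℝ => poleKernel p N r (l - 2 * Real.pi * Complex.I) x) (x - Real.log r) :=
    fun x => by
      have e : (x : ℂ) + Real.pi * Complex.I + s₀ =
          ((x - Real.log r : ℝ) : ℂ) + 2 * Real.pi * Complex.I := by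
        rw [hs₀]; push_cast; ring
      have e2 : Complex.exp (((N : ℝ) : ℂ) * (2 * Real.pi * Complex.I)) = 1 :=
        Complex.exp_eq_one_iff.2 ⟨N, by push_cast; ring⟩
      simp only [hh, poleKernel, hexp]
      rw [e, expGauss_add, e2, one_mul]
  have hlim := tendsto_norm_expGauss hp0 hp1 N l.re
  set Y := Real.pi + Real.pi + |l.im| with hY
  have hshift : Tendsto (fun x : ℝ => x - Real.log r) atTop atTop :=
    tendsto_atTop_add_const_right _ _ tendsto_id
  have hshift' : Tendsto (fun x : ℝ => x - Real.log r) atBot atBot :=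
    tendsto_atBot_add_const_right _ _ tendsto_id
  have key := integral_residue_strip (h := h)
    ((differentiable_expGauss p _ l).comp (differentiable_id.add_const s₀))
    (e := fun x : ℝ => ‖expGauss p (N : ℝ) l.re ((x - Real.log r : ℝ) : ℂ)‖ *
      Real.exp (-Y ^ 2 / (2 * Real.log p)))
    (by simpa using (hlim.1.comp hshift).mul_const _)
    (by simpa using (hlim.2.comp hshift').mul_const _)
    (fun x y hy => by
      have e : (x : ℂ) + y * Complex.I + s₀ =
          ((x - Real.log r : ℝ) : ℂ) + ((y + Real.pi : ℝ) : ℂ) * Complex.I := by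
        rw [hs₀]; push_cast; ring
      simp only [hh]
      rw [e]
      refine norm_expGauss_strip_le hp0 hp1 N l _ ?_
      refine (abs_sub _ _).trans ?_
      have := abs_add_le y Real.pi
      rw [abs_of_pos Real.pi_pos] at this
      linarith)
    (by
      simp only [hplus]
      exact (integrable_poleKernel hp0 hp1 N hr _).comp_sub_right _)
    (by
      simp only [hminus]
      exact (integrable_poleKernel hp0 hp1 N hr _).comp_sub_right _)
  simp only [hplus, hminus] at key
  rw [integral_sub_right_eq_self (fun x : ℝ => poleKernel p N r _ x),
    integral_sub_right_eq_self (fun x : ℝ => poleKernel p N r _ x)] at key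
  simpa [hh, poleIntegral] using key

lemma norm_lapConst_mul_poleIntegral_le {p : ℝ} (hp0 : 0 < p) (hp1 : p < 1) (N : ℕ) {r : ℝ}
    (hr : 0 < r) (l : ℂ) :
    ‖(lapConst p : ℂ) * poleIntegral p N r l‖ ≤
      Real.exp (N * l.re - Real.log p * ((N : ℝ) * (N - 1) / 2)) *
        Real.exp (-l.im ^ 2 / (2 * Real.log p)) := by
  have hC := lapConst_pos hp0 hp1
  rw [← lapConst_mul_integral_norm_expGauss hp0 hp1, norm_mul, Complex.norm_real,
    Real.norm_of_nonneg hC.le]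
  gcongr
  exact norm_integral_le_of_norm_le (integrable_expGauss hp0 hp1 _ _).norm
    (ae_of_all _ fun x => norm_poleKernel_ofReal_le hr p N l x)

/-- The density `e^{Nx} E_q(e^x) / (1 + r e^x)` on the real line, valued in the nonnegative reals: the
kernel at `l = 0` is positive there, hence equal to its norm. -/
noncomputable def poleDensity (p : ℝ) (N : ℕ) (r : ℝ) (x : ℝ) : NNReal :=
  ‖poleKernel p N r 0 x‖₊

lemma continuous_poleKernel_ofReal (p : ℝ) (N : ℕ) {r : ℝ} (hr : 0 < r) (l : ℂ) :
    Continuous fun x : ℝ => poleKernel p N r l x :=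
  continuous_iff_continuousAt.2 fun x =>
    ContinuousAt.comp (f := fun x : ℝ => (x : ℂ))
      (differentiableAt_poleKernel p N l (one_add_mul_exp_ne_zero hr
        (by simpa using Real.pi_pos))).continuousAt Complex.continuous_ofReal.continuousAt

lemma poleKernel_eq_density {p : ℝ} (hp0 : 0 < p) (hp1 : p < 1) (N : ℕ) {r : ℝ} (hr : 0 < r)
    (l : ℂ) (x : ℝ) :
    poleKernel p N r l x = Complex.exp (l / 2 + l ^ 2 / (2 * Real.log p)) *
      ((poleDensity p N r x : ℝ) • Complex.exp (-l / Real.log p * x)) := by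
  have hL := ofReal_log_ne_zero hp0 hp1
  have h1 : expGauss p (N : ℝ) 0 x / (1 + r * Complex.exp x) = ((poleDensity p N r x : ℝ) : ℂ) := by
    have hpos : 0 ≤ 1 + r * Real.exp x := by positivity
    have h2 := expGauss_ofReal p N 0 x
    rw [Complex.ofReal_zero] at h2
    rw [poleDensity, coe_nnnorm, poleKernel, norm_div]
    have h3 : (1 : ℂ) + r * Complex.exp x = ((1 + r * Real.exp x : ℝ) : ℂ) := by push_cast; rfl
    rw [h3, Complex.norm_real, Real.norm_of_nonneg hpos, Complex.ofReal_div, ← h2]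
  have h4 : expGauss p (N : ℝ) l x = Complex.exp (l / 2 + l ^ 2 / (2 * Real.log p)) *
      Complex.exp (-l / Real.log p * x) * expGauss p (N : ℝ) 0 x := by
    simp only [expGauss, gaussE, ← Complex.exp_add]
    congr 1
    field_simp
    ring
  rw [poleKernel, h4, mul_div_assoc, h1, Complex.real_smul]
  ring

/-- Up to an elementary factor, `poleIntegral` is the Laplace transform of a positive density all
of whose exponential moments are finite. -/
lemma differentiable_poleIntegral {p : ℝ} (hp0 : 0 < p) (hp1 : p < 1) (N : ℕ) {r : ℝ}
    (hr : 0 < r) : Differentiable ℂ (poleIntegral p N r) := by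
  have hlog := Real.log_neg hp0 hp1
  have hL := ofReal_log_ne_zero hp0 hp1
  have hmeas : Measurable (poleDensity p N r) :=
    (continuous_poleKernel_ofReal p N hr 0).measurable.nnnorm
  set μ : Measure ℝ := volume.withDensity fun x => (poleDensity p N r x : ENNReal) with hμ
  have hset : ProbabilityTheory.integrableExpSet id μ = Set.univ := by
    refine Set.eq_univ_of_forall fun t => ?_
    have h1 : Integrable fun x : ℝ => (poleDensity p N r x : ℝ) • Real.exp (t * id x) := by
      have h2 := (integrable_poleKernel hp0 hp1 N hr ((-t * Real.log p : ℝ) : ℂ)).norm.const_mul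
        ‖Complex.exp (((-t * Real.log p : ℝ) : ℂ) / 2 +
          ((-t * Real.log p : ℝ) : ℂ) ^ 2 / (2 * Real.log p))‖⁻¹
      refine h2.congr (ae_of_all _ fun x => ?_)
      have h3 : -((-t * Real.log p : ℝ) : ℂ) / Real.log p = t := by push_cast; field_simp
      simp only
      rw [poleKernel_eq_density hp0 hp1 N hr, h3, norm_mul,
        inv_mul_cancel_left₀ (norm_ne_zero_iff.2 (Complex.exp_ne_zero _)), norm_smul,
        Complex.norm_exp, Real.norm_of_nonneg (NNReal.coe_nonneg _)]
      simp
    exact (integrable_withDensity_iff_integrable_coe_smul hmeas).2 h1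
  have hd : Differentiable ℂ (ProbabilityTheory.complexMGF id μ) := fun z =>
    (ProbabilityTheory.analyticAt_complexMGF (by simp [hset])).differentiableAt
  have heq : poleIntegral p N r = fun l => Complex.exp (l / 2 + l ^ 2 / (2 * Real.log p)) *
      ProbabilityTheory.complexMGF id μ (-l / Real.log p) := by
    funext l
    rw [poleIntegral, ProbabilityTheory.complexMGF, hμ,
      integral_withDensity_eq_integral_smul hmeas, ← integral_const_mul]
    exact integral_congr_ae (ae_of_all _ fun x => poleKernel_eq_density hp0 hp1 N hr l x)
  rw [heq]
  exact Differentiable.mul (by fun_prop) (hd.comp (by fun_prop))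

/-! ### Logarithmic coordinates -/

lemma exp_image_univ : Real.exp '' Set.univ = Set.Ioi 0 := by
  rw [Set.image_univ, Real.range_exp]

lemma integrableOn_Ioi_iff_exp (f : ℝ → ℂ) :
    IntegrableOn f (Set.Ioi 0) ↔ Integrable fun x : ℝ => (Real.exp x : ℂ) * f (Real.exp x) := by
  rw [← exp_image_univ, integrableOn_image_iff_integrableOn_abs_deriv_smul MeasurableSet.univ
    (fun x _ => (Real.hasDerivAt_exp x).hasDerivWithinAt) Real.exp_injective.injOn,
    integrableOn_univ]
  simp [Complex.real_smul]

lemma integral_Ioi_eq_exp (f : ℝ → ℂ) :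
    ∫ t in Set.Ioi (0 : ℝ), f t = ∫ x : ℝ, (Real.exp x : ℂ) * f (Real.exp x) := by
  rw [← exp_image_univ, integral_image_eq_integral_abs_deriv_smul MeasurableSet.univ
    (fun x _ => (Real.hasDerivAt_exp x).hasDerivWithinAt) Real.exp_injective.injOn,
    setIntegral_univ]
  simp [Complex.real_smul]

lemma exp_mul_laplaceIntegrand (p : ℝ) (B : ℂ → ℂ) (l : ℂ) (x : ℝ) :
    (Real.exp x : ℂ) * laplaceIntegrand p B l (Real.exp x) =
      B (Complex.exp x) * gaussE p (x - l) := by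
  have h : (Real.exp x : ℂ) ≠ 0 := by exact_mod_cast (Real.exp_pos x).ne'
  rw [laplaceIntegrand, Real.log_exp, mul_div_cancel₀ _ h, Complex.ofReal_exp]

lemma exp_mul_hyperIntegrand (p : ℝ) {σ : ℝ} (hσ : 0 < σ) (N : ℕ) {l : ℂ}
    (x : ℝ) :
    (Real.exp x : ℂ) * hyperIntegrand p (1 / Complex.exp l) N σ (Real.exp x) =
      σ⁻¹ * Complex.exp ((1 - N) * l) * poleKernel p N σ⁻¹ l (x + l) := by
  have hx : (Real.exp x : ℂ) ≠ 0 := by exact_mod_cast (Real.exp_pos x).ne'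
  have hl := Complex.exp_ne_zero l
  have hσ' : (σ : ℂ) ≠ 0 := by exact_mod_cast hσ.ne'
  have hden : (Real.exp x : ℂ) + σ * (1 / Complex.exp l) =
      σ * Complex.exp (-l) * (1 + (σ⁻¹ : ℝ) * Complex.exp (x + l)) := by
    rw [Complex.exp_add, Complex.exp_neg, ← Complex.ofReal_exp]; push_cast; field_simp; ring
  have hpow : (Real.exp x : ℂ) * (Real.exp x : ℂ) ^ ((N : ℤ) - 1) = Complex.exp (N * x) := by
    rw [zpow_sub_one₀ hx, zpow_natCast, mul_comm, mul_assoc, inv_mul_cancel₀ hx, mul_one,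
      Complex.ofReal_exp, ← Complex.exp_nat_mul]
  rw [hyperIntegrand, Real.log_exp, hden, poleKernel, expGauss_add, sub_self, expGauss, sub_zero,
    ← mul_div_assoc, ← mul_assoc, hpow]
  have h3 : Complex.exp ((1 - N) * l) * Complex.exp (((N : ℝ) : ℂ) * l) = Complex.exp l := by
    rw [← Complex.exp_add]; congr 1; push_cast; ring
  have h4 : Complex.exp (-l) = (Complex.exp l)⁻¹ := Complex.exp_neg l
  rw [h4, ← mul_div_assoc, ← div_div, Complex.ofReal_natCast] at *
  congr 1
  push_cast
  field_simp
  linear_combination (-gaussE p x) * h3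

/-- The continuation of `z ↦ F_q(1/z; N, σ)` to the Riemann surface of the logarithm. -/
noncomputable def hyperCont (p : ℝ) (N : ℕ) (σ : ℝ) (l : ℂ) : ℂ :=
  (σ : ℂ) ^ (-(N : ℤ)) * Complex.exp ((1 - N) * l) * ((lapConst p : ℂ) * poleIntegral p N σ⁻¹ l)

lemma isHyperterminantContinuation_hyperCont {p : ℝ} (hp0 : 0 < p) (hp1 : p < 1) (N : ℕ) {σ : ℝ}
    (hσ : 0 < σ) : IsHyperterminantContinuation p N σ (hyperCont p N σ) := by
  have hσi : 0 < σ⁻¹ := inv_pos.2 hσ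
  have hσ' : (σ : ℂ) ≠ 0 := by exact_mod_cast hσ.ne'
  refine ⟨?_, fun l hl => ⟨?_, ?_⟩⟩
  · have := differentiable_poleIntegral hp0 hp1 N hσi
    unfold hyperCont
    fun_prop
  · rw [integrableOn_Ioi_iff_exp]
    simp only [exp_mul_hyperIntegrand p hσ]
    exact (integrable_poleKernel_line hp0 hp1 N hσi l l hl).const_mul _
  · rw [hyperterminant, integral_Ioi_eq_exp]
    simp only [exp_mul_hyperIntegrand p hσ]
    rw [integral_const_mul, integral_poleKernel_add hp0 hp1 N hσi l l hl, hyperCont,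
      sub_eq_add_neg (1 : ℤ), zpow_add₀ hσ', zpow_one]
    push_cast
    field_simp

/-! ### The `q`-Borel-Laplace sum -/

lemma norm_ofReal_of_pos {p : ℝ} (hp0 : 0 < p) : ‖(p : ℂ)‖ = p := by
  rw [Complex.norm_real, Real.norm_of_nonneg hp0.le]

lemma one_add_exp_mul_pow_ne_zero {p : ℝ} (hp0 : 0 < p) (x : ℝ) (j : ℕ) :
    1 + Complex.exp x * (p : ℂ) ^ j ≠ 0 := by
  have : (0 : ℝ) < 1 + Real.exp x * p ^ j := by positivity
  exact_mod_cast this.ne'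

lemma exp_log_mul_natCast {p : ℝ} (hp0 : 0 < p) (k : ℕ) :
    Complex.exp (Real.log p * k) = (p : ℂ) ^ k := by
  rw [mul_comm, Complex.exp_nat_mul, ← Complex.ofReal_exp, Real.exp_log hp0]

/-- The integrand of the `q`-Laplace transform, split into the initial monomials and the partial
fractions of the `q`-Borel transform. -/
lemma borelSum_exp_mul_gaussE {a b : ℂ} {p : ℝ} (N : ℕ) (l : ℂ) (x : ℝ) :
    borelSum a b p N (Complex.exp x) * gaussE p (x - l) =
      ∑ n ∈ Finset.range N, lateCoeff a b p n * (-1) ^ n * expGauss p (n : ℝ) l x +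
        ∑' j, (-1) ^ N * (resCoeff a b p j * (p : ℂ) ^ (j * N)) *
          poleKernel p N (p ^ j) l x := by
  have hpow : ∀ n : ℕ, (-Complex.exp x) ^ n * gaussE p (x - l) =
      (-1) ^ n * expGauss p (n : ℝ) l x := fun n => by
    rw [expGauss, neg_pow, ← Complex.exp_nat_mul, mul_assoc, Complex.ofReal_natCast]
  rw [borelSum, add_mul, Finset.sum_mul]
  congr 1
  · refine Finset.sum_congr rfl fun n _ => ?_
    rw [mul_assoc, hpow, mul_assoc]
  · rw [mul_right_comm, hpow, ← tsum_mul_left]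
    refine tsum_congr fun j => ?_
    rw [polarTerm, poleKernel, Complex.ofReal_pow, mul_comm (Complex.exp x)]
    ring

lemma norm_tail_le {a b : ℂ} {p : ℝ} (hp0 : 0 < p) {N : ℕ} (l : ℂ) (x : ℝ) (j : ℕ) :
    ‖(-1) ^ N * (resCoeff a b p j * (p : ℂ) ^ (j * N)) * poleKernel p N (p ^ j) l x‖ ≤
      (‖resCoeff a b p j‖ * ‖(p : ℂ)‖ ^ (j * N)) * ‖expGauss p (N : ℝ) l x‖ := by
  simp only [norm_mul, norm_pow, norm_neg, norm_one, one_pow, one_mul]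
  gcongr
  exact norm_poleKernel_ofReal_le (pow_pos hp0 j) p N l x

lemma integrable_borelSum_mul_gaussE {a b : ℂ} {p : ℝ} (hp0 : 0 < p) (hp1 : p < 1) {N : ℕ}
    (hN : IsLate a b p N) (l : ℂ) :
    Integrable fun x : ℝ => borelSum a b p N (Complex.exp x) * gaussE p (x - l) := by
  have hq1 : ‖(p : ℂ)‖ < 1 := by rwa [norm_ofReal_of_pos hp0]
  have hb : Integrable fun x : ℝ =>
      ∑ n ∈ Finset.range N, ‖lateCoeff a b p n * (-1) ^ n * expGauss p (n : ℝ) l x‖ +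
        (∑' j, ‖resCoeff a b p j‖ * ‖(p : ℂ)‖ ^ (j * N)) * ‖expGauss p (N : ℝ) l x‖ :=
    (integrable_finsetSum _ fun n _ => ((integrable_expGauss hp0 hp1 _ l).const_mul _).norm).add
      ((integrable_expGauss hp0 hp1 _ l).norm.const_mul _)
  refine hb.mono' (Continuous.aestronglyMeasurable ?_) (ae_of_all _ fun x => ?_)
  · refine Continuous.mul (continuous_iff_continuousAt.2 fun x => ?_)
      ((differentiable_gaussE p).continuous.comp (by fun_prop))
    exact ContinuousAt.comp (f := fun x : ℝ => Complex.exp x)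
      (analyticAt_borelSum hq1 hN (one_add_exp_mul_pow_ne_zero hp0 x)).continuousAt
      (by fun_prop)
  · rw [borelSum_exp_mul_gaussE]
    refine (norm_add_le _ _).trans (add_le_add (norm_sum_le _ _) ?_)
    exact tsum_of_norm_bounded ((hN.summable_norm hq1).hasSum.mul_right _)
      fun j => norm_tail_le hp0 l x j

lemma integrableOn_laplaceIntegrand {a b : ℂ} {p : ℝ} (hp0 : 0 < p) (hp1 : p < 1) {N : ℕ}
    (hN : IsLate a b p N) (l : ℂ) :
    IntegrableOn (laplaceIntegrand p (borelSum a b p N) l) (Set.Ioi 0) := by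
  rw [integrableOn_Ioi_iff_exp]
  simp only [exp_mul_laplaceIntegrand]
  exact integrable_borelSum_mul_gaussE hp0 hp1 hN l

lemma qLaplace_borelSum_eq {a b : ℂ} {p : ℝ} (hp0 : 0 < p) (hp1 : p < 1) {N M : ℕ}
    (hN : IsLate a b p N) (hM : IsLate a b p M) (l : ℂ) :
    qLaplace p (borelSum a b p N) l = qLaplace p (borelSum a b p M) l := by
  have hq1 : ‖(p : ℂ)‖ < 1 := by rwa [norm_ofReal_of_pos hp0]
  rw [qLaplace, qLaplace, integral_Ioi_eq_exp, integral_Ioi_eq_exp]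
  simp only [exp_mul_laplaceIntegrand]
  congr 2
  funext x
  rw [borelSum_eq hq1 hN hM (one_add_exp_mul_pow_ne_zero hp0 x)]

lemma cast_triangle (n : ℕ) : ((n * (n - 1) / 2 : ℕ) : ℂ) = n * (n - 1) / 2 := by
  rw [← Nat.choose_two_right, Nat.cast_choose_two]

lemma cast_triangle_succ (n : ℕ) : ((n * (n + 1) / 2 : ℕ) : ℂ) = n * (n + 1) / 2 := by
  have h := cast_triangle (n + 1)
  rw [Nat.add_sub_cancel, mul_comm (n + 1) n] at h
  rw [h]; push_cast; ring

lemma phiCoeff_two_zero (a b q : ℂ) (n : ℕ) :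
    phiCoeff [a, b] [] q n = lateCoeff a b q n * (-1) ^ n * (q ^ (n * (n - 1) / 2))⁻¹ := by
  have h : (1 + (([] : List ℂ).length : ℤ) - (([a, b] : List ℂ).length : ℤ)) = -1 := by simp
  rw [phiCoeff, h, zpow_neg_one, mul_inv, ← inv_pow]
  simp [lateCoeff, mul_assoc]

lemma phiCoeff_two_one (a b q : ℂ) (n : ℕ) :
    phiCoeff [a, b] [0] q n = lateCoeff a b q n := by
  have h : (1 + (([0] : List ℂ).length : ℤ) - (([a, b] : List ℂ).length : ℤ)) = 0 := by simp
  rw [phiCoeff, h, zpow_zero]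
  simp [lateCoeff, qPoch]

lemma lapConst_mul_integral_monomial (a b : ℂ) {p : ℝ} (hp0 : 0 < p) (hp1 : p < 1) (n : ℕ)
    (l : ℂ) :
    (lapConst p : ℂ) * ∫ x : ℝ, lateCoeff a b p n * (-1) ^ n * expGauss p (n : ℝ) l x =
      phiCoeff [a, b] [] p n * Complex.exp l ^ n := by
  rw [integral_const_mul, mul_left_comm, lapConst_mul_integral_expGauss hp0 hp1,
    phiCoeff_two_zero, Complex.exp_sub, ← exp_log_mul_natCast hp0 (n * (n - 1) / 2),
    cast_triangle, ← Complex.exp_nat_mul, Complex.ofReal_natCast, div_eq_mul_inv]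
  ring

/-- The `q`-Laplace transform, term by term: an initial segment of the divergent series, followed
by a convergent series of integrals over the partial fractions. -/
lemma hasSum_qLaplace {a b : ℂ} {p : ℝ} (hp0 : 0 < p) (hp1 : p < 1) {N : ℕ}
    (hN : IsLate a b p N) (l : ℂ) :
    HasSum (fun j => (-1) ^ N * (resCoeff a b p j * (p : ℂ) ^ (j * N)) *
        ((lapConst p : ℂ) * poleIntegral p N (p ^ j) l))
      (qLaplace p (borelSum a b p N) l -
        ∑ n ∈ Finset.range N, phiCoeff [a, b] [] p n * Complex.exp l ^ n) := by
  have hq1 : ‖(p : ℂ)‖ < 1 := by rwa [norm_ofReal_of_pos hp0]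
  set F : ℕ → ℝ → ℂ := fun j x => (-1) ^ N * (resCoeff a b p j * (p : ℂ) ^ (j * N)) *
    poleKernel p N (p ^ j) l x with hF
  have hFi : ∀ j, Integrable (F j) := fun j =>
    (integrable_poleKernel hp0 hp1 N (pow_pos hp0 j) l).const_mul _
  have hFs : Summable fun j => ∫ x, ‖F j x‖ := by
    refine ((hN.summable_norm hq1).mul_right (∫ x : ℝ, ‖expGauss p (N : ℝ) l x‖)).of_nonneg_of_le
      (fun j => integral_nonneg fun _ => norm_nonneg _) fun j => ?_
    rw [← integral_const_mul]
    exact integral_mono (hFi j).norm ((integrable_expGauss hp0 hp1 _ l).norm.const_mul _)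
      fun x => norm_tail_le hp0 l x j
  have h1 := (hasSum_integral_of_summable_integral_norm hFi hFs).mul_left (lapConst p : ℂ)
  have hmono : ∀ n ∈ Finset.range N, Integrable fun x : ℝ =>
      lateCoeff a b p n * (-1) ^ n * expGauss p (n : ℝ) l x :=
    fun n _ => (integrable_expGauss hp0 hp1 _ l).const_mul _
  have h2 : ∫ x, ∑' j, F j x =
      (∫ x : ℝ, borelSum a b p N (Complex.exp x) * gaussE p (x - l)) -
        ∑ n ∈ Finset.range N, ∫ x : ℝ, lateCoeff a b p n * (-1) ^ n * expGauss p (n : ℝ) l x := by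
    rw [← integral_finsetSum _ hmono, ← integral_sub (integrable_borelSum_mul_gaussE hp0 hp1 hN l)
      (integrable_finsetSum _ hmono)]
    refine integral_congr_ae (ae_of_all _ fun x => ?_)
    simp only [borelSum_exp_mul_gaussE, hF]
    ring
  have h3 : (lapConst p : ℂ) * ∫ x, ∑' j, F j x = qLaplace p (borelSum a b p N) l -
      ∑ n ∈ Finset.range N, phiCoeff [a, b] [] p n * Complex.exp l ^ n := by
    rw [h2, mul_sub, Finset.mul_sum, qLaplace, integral_Ioi_eq_exp]
    simp only [exp_mul_laplaceIntegrand, lapConst_mul_integral_monomial a b hp0 hp1]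
  rw [h3] at h1
  refine h1.congr_fun fun j => ?_
  simp only [hF]
  rw [integral_const_mul, poleIntegral]
  ring

/-! ### The Stokes phenomenon -/

lemma gaussE_sub_natCast_mul_log {p : ℝ} (hp0 : 0 < p) (hp1 : p < 1) (w : ℂ) (j : ℕ) :
    gaussE p (w - j * Real.log p) =
      gaussE p w * (Complex.exp (-w) ^ j * (p : ℂ) ^ (j * (j + 1) / 2)) := by
  have hL := ofReal_log_ne_zero hp0 hp1
  rw [← exp_log_mul_natCast hp0, cast_triangle_succ, ← Complex.exp_nat_mul, gaussE, gaussE,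
    ← Complex.exp_add, ← Complex.exp_add]
  congr 1
  field_simp
  ring

lemma stokes_term {p : ℝ} (hp0 : 0 < p) (hp1 : p < 1) (N j : ℕ) (l : ℂ) :
    (-1) ^ N * (p : ℂ) ^ (j * N) *
      expGauss p (N : ℝ) l (Real.pi * Complex.I - Real.log (p ^ j)) =
      gaussE p (Real.pi * Complex.I - l) * ((p : ℂ) ^ (j * (j + 1) / 2) * (-Complex.exp l) ^ j) := by
  have h1 : (Real.pi : ℂ) * Complex.I - Real.log (p ^ j) - l =
      (Real.pi * Complex.I - l) - j * Real.log p := by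
    rw [Real.log_pow]; push_cast; ring
  have h2 : Complex.exp (-(Real.pi * Complex.I - l)) = -Complex.exp l := by
    rw [neg_sub, exp_sub_pi_mul_I]
  have h3 : Complex.exp (((N : ℝ) : ℂ) * (Real.pi * Complex.I - Real.log (p ^ j))) =
      (-1) ^ N * ((p : ℂ) ^ (j * N))⁻¹ := by
    rw [Complex.ofReal_natCast, Complex.exp_nat_mul, Complex.exp_sub, Complex.exp_pi_mul_I,
      ← Complex.ofReal_exp, Real.exp_log (pow_pos hp0 j), div_pow, pow_mul, Complex.ofReal_pow,
      div_eq_mul_inv]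
  have h4 : (p : ℂ) ^ (j * N) ≠ 0 := pow_ne_zero _ (by exact_mod_cast hp0.ne')
  have h5 : ((-1 : ℂ) ^ N) * (-1) ^ N = 1 := by rw [← mul_pow]; simp
  rw [expGauss, h1, h3, gaussE_sub_natCast_mul_log hp0 hp1, h2]
  field_simp
  linear_combination (gaussE p (Real.pi * Complex.I - l) * (p : ℂ) ^ (j * (j + 1) / 2)) * h5

lemma hasSum_stokes {a b : ℂ} {p : ℝ} (hp0 : 0 < p) (hp1 : p < 1) {N : ℕ}
    (hN : IsLate a b p N) (l : ℂ) :
    HasSum (fun n : ℕ => 2 * (Real.pi : ℂ) * Complex.I * (lapConst p : ℂ) *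
        gaussE p ((Real.pi : ℂ) * Complex.I - l) *
          (resCoeff a b p n * (p : ℂ) ^ (n * (n + 1) / 2) * (-Complex.exp l) ^ n))
      (qLaplace p (borelSum a b p N) (l - 2 * (Real.pi : ℂ) * Complex.I) -
        qLaplace p (borelSum a b p N) l) := by
  have h1 := (hasSum_qLaplace hp0 hp1 hN (l - 2 * (Real.pi : ℂ) * Complex.I)).sub
    (hasSum_qLaplace hp0 hp1 hN l)
  have hper : Complex.exp (l - 2 * Real.pi * Complex.I) = Complex.exp l := by
    rw [Complex.exp_sub, Complex.exp_two_pi_mul_I, div_one]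
  rw [hper, sub_sub_sub_cancel_right] at h1
  refine h1.congr_fun fun j => ?_
  have h2 := poleIntegral_sub hp0 hp1 N (pow_pos hp0 j) l
  have h3 := stokes_term hp0 hp1 N j l
  linear_combination (-2 * (Real.pi : ℂ) * Complex.I * lapConst p * resCoeff a b p j) * h3 -
    ((-1) ^ N * (resCoeff a b p j * (p : ℂ) ^ (j * N)) * lapConst p) * h2

lemma stokes_isBigO {a b : ℂ} {p : ℝ} (hp0 : 0 < p) (hp1 : p < 1) {N : ℕ}
    (hN : IsLate a b p N) (M : ℕ) :
    (fun l : ℂ => qLaplace p (borelSum a b p N) (l - 2 * (Real.pi : ℂ) * Complex.I) -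
        qLaplace p (borelSum a b p N) l -
        2 * (Real.pi : ℂ) * Complex.I * (lapConst p : ℂ) *
          gaussE p ((Real.pi : ℂ) * Complex.I - l) *
          ∑ n ∈ Finset.range M,
            resCoeff a b p n * (p : ℂ) ^ (n * (n + 1) / 2) * (-Complex.exp l) ^ n)
      =O[comap Complex.re atBot]
    (fun l : ℂ => gaussE p ((Real.pi : ℂ) * Complex.I - l) * Complex.exp l ^ M) := by
  have hC : (lapConst p : ℂ) ≠ 0 := by exact_mod_cast (lapConst_pos hp0 hp1).ne'
  have hsum : Summable fun n => ‖resCoeff a b p (n + M) *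
      (p : ℂ) ^ ((n + M) * (n + M + 1) / 2)‖ := by
    -- Convergence of the Stokes series at `z = 1` makes its coefficients absolutely summable.
    have h1 := (hasSum_stokes hp0 hp1 hN 0).summable
    rw [summable_mul_left_iff (by
      simp only [ne_eq, mul_eq_zero, not_or]
      exact ⟨⟨⟨⟨two_ne_zero, by exact_mod_cast Real.pi_ne_zero⟩, Complex.I_ne_zero⟩, hC⟩,
        Complex.exp_ne_zero _⟩)] at h1
    refine ((summable_nat_add_iff M).2 h1.norm).congr fun n => ?_
    simp
  refine Asymptotics.IsBigO.of_bound (‖2 * (Real.pi : ℂ) * Complex.I * (lapConst p : ℂ)‖ *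
    ∑' n, ‖resCoeff a b p (n + M) * (p : ℂ) ^ ((n + M) * (n + M + 1) / 2)‖) ?_
  filter_upwards [preimage_mem_comap (Iic_mem_atBot (0 : ℝ))] with l hl
  have h1 := (hasSum_nat_add_iff' M).2 (hasSum_stokes hp0 hp1 hN l)
  rw [← Finset.mul_sum] at h1
  rw [← h1.tsum_eq, ← tsum_mul_left, ← tsum_mul_right]
  refine tsum_of_norm_bounded ((hsum.mul_left _).mul_right _).hasSum fun n => ?_
  have hz : ‖Complex.exp l‖ ≤ 1 := by
    rw [Complex.norm_exp]; exact Real.exp_le_one_iff.2 hl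
  have hz' : ‖Complex.exp l‖ ^ (n + M) ≤ ‖Complex.exp l‖ ^ M :=
    pow_le_pow_of_le_one (norm_nonneg _) hz (Nat.le_add_left M n)
  simp only [norm_mul, norm_pow, norm_neg] at *
  calc _ = ‖(2 : ℂ)‖ * ‖(Real.pi : ℂ)‖ * ‖Complex.I‖ * ‖(lapConst p : ℂ)‖ *
        (‖resCoeff a b p (n + M)‖ * ‖(p : ℂ)‖ ^ ((n + M) * (n + M + 1) / 2)) *
        (‖gaussE p (Real.pi * Complex.I - l)‖ * ‖Complex.exp l‖ ^ (n + M)) := by ring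
    _ ≤ _ := by gcongr

/-! ### Re-expansion in hyperterminants and exponential improvement -/

lemma hyperCont_term {p : ℝ} (hp0 : 0 < p) (N j : ℕ) (δ l : ℂ) :
    -(-Complex.exp l) ^ ((N : ℤ) - 1) * (δ * hyperCont p N (p ^ (-(j : ℤ))) l) =
      (-1) ^ N * (δ * (p : ℂ) ^ (j * N)) * ((lapConst p : ℂ) * poleIntegral p N (p ^ j) l) := by
  have hl := Complex.exp_ne_zero l
  have hp : (p : ℂ) ≠ 0 := by exact_mod_cast hp0.ne'
  have h1 : (p ^ (-(j : ℤ)))⁻¹ = p ^ j := by rw [zpow_neg, inv_inv, zpow_natCast]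
  have h2 : ((p ^ (-(j : ℤ)) : ℝ) : ℂ) ^ (-(N : ℤ)) = (p : ℂ) ^ (j * N) := by
    rw [Complex.ofReal_zpow, ← zpow_mul, neg_mul_neg, ← Nat.cast_mul, zpow_natCast]
  have h3 : (-Complex.exp l) ^ ((N : ℤ) - 1) * Complex.exp ((1 - N) * l) = -(-1) ^ N := by
    rw [sub_mul, one_mul, Complex.exp_sub, Complex.exp_nat_mul, zpow_sub_one₀ (neg_ne_zero.2 hl),
      zpow_natCast, neg_pow]
    field_simp
  rw [hyperCont, h1, h2]
  linear_combination (-δ * (p : ℂ) ^ (j * N) * (lapConst p * poleIntegral p N (p ^ j) l)) * h3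

lemma hasSum_hyperCont {a b : ℂ} {p : ℝ} (hp0 : 0 < p) (hp1 : p < 1) {N : ℕ}
    (hN : IsLate a b p N) (l : ℂ) :
    HasSum (fun j : ℕ => -(-Complex.exp l) ^ ((N : ℤ) - 1) *
        (resCoeff a b p j * hyperCont p N (p ^ (-(j : ℤ))) l))
      (qLaplace p (borelSum a b p N) l -
        ∑ n ∈ Finset.range N, phiCoeff [a, b] [] p n * Complex.exp l ^ n) := by
  simp only [hyperCont_term hp0]
  exact hasSum_qLaplace hp0 hp1 hN l

/-- The size of the Gaussian moment at a truncation index `N = x / ln p + κ` near the optimal one: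
completing the square shows that it is `E_q(e^{-x})` up to a factor depending on `κ` only. -/
lemma optimal_exponent {L x N : ℝ} (hL : L ≠ 0) :
    N * x - L * (N * (N - 1) / 2) =
      (-x - L / 2) ^ 2 / (2 * L) + -L * (N - x / L - 1 / 2) ^ 2 / 2 := by
  field_simp
  ring

lemma abs_sub_div_log_le {p : ℝ} (hp0 : 0 < p) (hp1 : p < 1) {l : ℂ} {Θ K N : ℝ}
    (hΘ : |l.im| ≤ Θ) (hx : l.re ≤ 0) (hN : |N - ‖l / (Real.log p : ℂ)‖| ≤ K) :
    |N - l.re / Real.log p| ≤ K + Θ / -Real.log p := by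
  have hL : 0 < -Real.log p := by linarith [Real.log_neg hp0 hp1]
  have h1 : ‖l / (Real.log p : ℂ)‖ = ‖l‖ / -Real.log p := by
    rw [norm_div, Complex.norm_real, Real.norm_eq_abs, abs_of_neg (by linarith)]
  have h2 : |‖l‖ / -Real.log p - l.re / Real.log p| ≤ Θ / -Real.log p := by
    have h3 : ‖l‖ / -Real.log p - l.re / Real.log p = (‖l‖ - |l.re|) / -Real.log p := by
      rw [abs_of_nonpos hx, sub_div, neg_div_neg_eq]
    have h4 := Complex.abs_re_le_norm l
    have h5 := Complex.norm_le_abs_re_add_abs_im l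
    rw [h3, abs_div, abs_of_pos hL, abs_of_nonneg (by linarith)]
    gcongr
    linarith
  rw [h1] at hN
  have h6 := abs_sub_le N (‖l‖ / -Real.log p) (l.re / Real.log p)
  linarith

/-- Exponential improvement at optimal truncation: the remaining terms are bounded by Gaussian
moments, and each carries a further factor `p^{jN}`, which is comparable to `|z|^j`. -/
lemma exists_remainder_bound {a b : ℂ} {p : ℝ} (hp0 : 0 < p) (hp1 : p < 1) {N₀ : ℕ}
    (hN₀ : IsLate a b p N₀) (Θ K : ℝ) (J : ℕ) :
    ∃ C ρ : ℝ, ∀ (l : ℂ) (N : ℕ),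
      |l.im| ≤ Θ → l.re < ρ → |(N : ℝ) - ‖l / (Real.log p : ℂ)‖| ≤ K →
        ‖qLaplace p (borelSum a b p N₀) l
            - ∑ n ∈ Finset.range N, phiCoeff [a, b] [] p n * Complex.exp l ^ n
            + (-Complex.exp l) ^ ((N : ℤ) - 1) *
                ∑ j ∈ Finset.range J, resCoeff a b p j * hyperCont p N (p ^ (-(j : ℤ))) l‖
          ≤ C * ‖gaussE p (-(l.re : ℂ))‖ * Real.exp l.re ^ J := by
  have hq0 : 0 < ‖(p : ℂ)‖ := by rwa [norm_ofReal_of_pos hp0]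
  have hq1 : ‖(p : ℂ)‖ < 1 := by rwa [norm_ofReal_of_pos hp0]
  set L := Real.log p with hL
  have hlog : L < 0 := Real.log_neg hp0 hp1
  set K' := K + Θ / -L with hK'
  set S := ∑' j, ‖resCoeff a b p (j + J)‖ * ‖(p : ℂ)‖ ^ (j * N₀) with hS
  -- `L * (N₀ + K')` forces `N ≥ N₀`.
  refine ⟨S * Real.exp (-L * J * K') * Real.exp (-L * (K' + 1 / 2) ^ 2 / 2) *
    Real.exp (-Θ ^ 2 / (2 * L)), min 0 (L * (N₀ + K')), fun l N hΘ hρ hN => ?_⟩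
  have hx0 : l.re ≤ 0 := (hρ.trans_le (min_le_left _ _)).le
  have hκ := abs_sub_div_log_le hp0 hp1 hΘ hx0 hN
  rw [← hL, ← hK'] at hκ
  have hκ' := abs_le.1 hκ
  have hNN : N₀ ≤ N := by
    have h1 : l.re < (N₀ + K') * L := by
      rw [mul_comm]; exact hρ.trans_le (min_le_right _ _)
    have h2 : (N₀ : ℝ) + K' < l.re / L := (lt_div_iff_of_neg hlog).2 h1
    have h3 : (N₀ : ℝ) < N := by linarith
    exact_mod_cast h3.le
  have hlate := hN₀.mono hq1 hNN
  rw [qLaplace_borelSum_eq hp0 hp1 hN₀ hlate]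
  have hsum := (hasSum_nat_add_iff' J).2 (hasSum_hyperCont hp0 hp1 hlate l)
  rw [← Finset.mul_sum, neg_mul, sub_neg_eq_add] at hsum
  rw [← hsum.tsum_eq]
  have hpN : p ^ N = Real.exp (L * N) := by
    rw [hL, Real.exp_mul, Real.exp_log hp0, Real.rpow_natCast]
  have hJ : ‖(p : ℂ)‖ ^ (J * N) ≤ Real.exp l.re ^ J * Real.exp (-L * J * K') := by
    rw [norm_ofReal_of_pos hp0, mul_comm J N, pow_mul, hpN, ← Real.exp_nat_mul,
      ← Real.exp_nat_mul, ← Real.exp_add]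
    refine Real.exp_le_exp.2 ?_
    have h1 : L * (N : ℝ) = l.re + L * (N - l.re / L) := by
      rw [mul_sub, mul_div_cancel₀ _ hlog.ne]; ring
    have h2 : L * (N - l.re / L) ≤ -L * K' := by nlinarith
    have h3 : (0 : ℝ) ≤ J := Nat.cast_nonneg J
    rw [h1]
    nlinarith [mul_le_mul_of_nonneg_left h2 h3]
  have hG : ∀ j : ℕ, ‖(lapConst p : ℂ) * poleIntegral p N (p ^ j) l‖ ≤
      ‖gaussE p (-(l.re : ℂ))‖ * Real.exp (-L * (K' + 1 / 2) ^ 2 / 2) *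
        Real.exp (-Θ ^ 2 / (2 * L)) := fun j => by
    refine (norm_lapConst_mul_poleIntegral_le hp0 hp1 N (pow_pos hp0 j) l).trans ?_
    rw [← hL, optimal_exponent hlog.ne, Real.exp_add, norm_gaussE, ← hL]
    have h1 : ((N : ℝ) - l.re / L - 1 / 2) ^ 2 ≤ (K' + 1 / 2) ^ 2 :=
      sq_le_sq' (by linarith) (by linarith)
    have h2 : l.im ^ 2 ≤ Θ ^ 2 := sq_le_sq' (by linarith [abs_le.1 hΘ]) (abs_le.1 hΘ).2
    have h3 : ((-(l.re : ℂ)).re - L / 2) ^ 2 - (-(l.re : ℂ)).im ^ 2 = (-l.re - L / 2) ^ 2 := by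
      simp
    rw [h3]
    have h4 : 0 ≤ -L := by linarith
    have h5 : -l.im ^ 2 / (2 * L) ≤ -Θ ^ 2 / (2 * L) := by
      rw [div_le_div_right_of_neg (by linarith)]; linarith
    gcongr
  refine (tsum_of_norm_bounded ((hN₀.summable_norm_shift hq0 hq1 J).mul_right
    (Real.exp l.re ^ J * Real.exp (-L * J * K') * (‖gaussE p (-(l.re : ℂ))‖ *
      Real.exp (-L * (K' + 1 / 2) ^ 2 / 2) * Real.exp (-Θ ^ 2 / (2 * L))))).hasSum
    fun j => ?_).trans (le_of_eq ?_)
  · have h1 : ‖(p : ℂ)‖ ^ (j * N) ≤ ‖(p : ℂ)‖ ^ (j * N₀) :=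
      pow_le_pow_of_le_one (norm_nonneg _) hq1.le (Nat.mul_le_mul_left j hNN)
    rw [hyperCont_term hp0, norm_mul, norm_mul, norm_mul, norm_pow, norm_neg, norm_one, one_pow,
      one_mul, norm_pow, add_mul, pow_add]
    calc _ = ‖resCoeff a b p (j + J)‖ * ‖(p : ℂ)‖ ^ (j * N) * (‖(p : ℂ)‖ ^ (J * N) *
          ‖(lapConst p : ℂ) * poleIntegral p N (p ^ (j + J)) l‖) := by ring
      _ ≤ _ := by
        gcongr
        exact hG (j + J)
  · rw [tsum_mul_right]; ring

/-- The residue constants `d_j`, extended by `0` to negative indices. -/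
noncomputable def resCoeffInt (a b q : ℂ) : ℤ → ℂ
  | Int.ofNat j => resCoeff a b q j
  | Int.negSucc _ => 0

lemma resCoeffInt_natCast (a b q : ℂ) (j : ℕ) : resCoeffInt a b q (j : ℤ) = resCoeff a b q j := rfl

lemma resCoeffInt_recurrence (a b : ℂ) {q : ℂ} (hq0 : 0 < ‖q‖) (hq1 : ‖q‖ < 1) {j : ℤ}
    (hj : 1 ≤ j) :
    (1 - q ^ (-j)) * resCoeffInt a b q j =
      (1 - (a + b) * q ^ (-j)) * resCoeffInt a b q (j - 1) +
        a * b * q ^ (-j) * resCoeffInt a b q (j - 2) := by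
  have hq : q ≠ 0 := norm_pos_iff.1 hq0
  obtain ⟨n, rfl⟩ : ∃ n : ℕ, j = (n : ℤ) + 1 := ⟨(j - 1).toNat, by omega⟩
  have h1 : ((n : ℤ) + 1) = ((n + 1 : ℕ) : ℤ) := by push_cast; rfl
  have h2 : ((n : ℤ) + 1 - 1) = (n : ℤ) := by ring
  have hqn : q ^ (n + 1) ≠ 0 := pow_ne_zero _ hq
  rw [h2, h1, resCoeffInt_natCast, resCoeffInt_natCast, zpow_neg, zpow_natCast]
  rcases n with _ | m
  · have h3 : resCoeffInt a b q (((0 + 1 : ℕ) : ℤ) - 2) = 0 := rfl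
    have h4 := resCoeff_one a b hq1
    rw [h3]
    simp only [zero_add, pow_one] at *
    field_simp
    linear_combination h4
  · have h3 : (((m + 1 + 1 : ℕ) : ℤ) - 2) = (m : ℤ) := by push_cast; ring
    have h4 := resCoeff_add_two a b hq1 m
    rw [h3, resCoeffInt_natCast]
    field_simp
    linear_combination h4

end QSeries

theorem mainTheorem3 (q a b : ℂ) (hq0 : 0 < ‖q‖) (hq1 : ‖q‖ < 1) :
    ∃ (B : ℂ → ℂ) (d : ℤ → ℂ),
      -- on the unit disc `B` is the sum of the `q`-Borel transform of `₂φ₀(a,b;-;q;z)`,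
      -- and this is `₂φ₁(a,b;0;q;-t)`
      (∀ t : ℂ, ‖t‖ < 1 →
        HasSum (fun n : ℕ => PowerSeries.coeff n
          (QSeries.qBorel q (QSeries.phiSeries [a, b] [] q)) * t ^ n) (B t) ∧
        HasSum (fun n : ℕ => QSeries.phiCoeff [a, b] [0] q n * (-t) ^ n) (B t)) ∧
      -- `B` is meromorphic on the plane, and analytic away from the points `-q^{-j}`
      (∀ t : ℂ, MeromorphicAt B t) ∧
      (∀ t : ℂ, (∀ j : ℕ, t ≠ -q ^ (-(j : ℤ))) → AnalyticAt ℂ B t) ∧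
      -- local behaviour `d_j / (1 + t q^j)` at `-q^{-j}`: a simple pole when `d_j ≠ 0`
      (∀ j : ℕ, ∃ h : ℂ → ℂ, AnalyticAt ℂ h (-q ^ (-(j : ℤ))) ∧
        ∀ᶠ t in nhdsWithin (-q ^ (-(j : ℤ))) {-q ^ (-(j : ℤ))}ᶜ,
          B t = d j / (1 + t * q ^ j) + h t) ∧
      (∀ j : ℕ, d j ≠ 0 → meromorphicOrderAt B (-q ^ (-(j : ℤ))) = -1) ∧
      -- initial values and recurrence for the `d_j`
      d (-1) = 0 ∧
      d 0 = QSeries.qPochInf a q * QSeries.qPochInf b q / QSeries.qPochInf q q ∧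
      (∀ j : ℤ, 1 ≤ j →
        (1 - q ^ (-j)) * d j =
          (1 - (a + b) * q ^ (-j)) * d (j - 1) + a * b * q ^ (-j) * d (j - 2)) ∧
      -- asymptotic expansion of the late coefficients
      (∀ J : ℕ,
        (fun n : ℕ => QSeries.qPoch a q n * QSeries.qPoch b q n / QSeries.qPoch q q n
            - ∑ j ∈ Finset.range J, d j * q ^ (j * n))
          =O[Filter.atTop] (fun n : ℕ => q ^ (J * n))) ∧
      -- the `q`-Borel-Laplace sum, for `0 < q < 1`; here `z = e^l`
      (∀ p : ℝ, 0 < p → q = (p : ℂ) →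
        (∀ l : ℂ, MeasureTheory.IntegrableOn (QSeries.laplaceIntegrand p B l)
          (Set.Ioi (0 : ℝ))) ∧
        -- the Stokes phenomenon, as a convergent expansion on the whole Riemann surface
        (∀ l : ℂ, HasSum
          (fun n : ℕ => 2 * (Real.pi : ℂ) * Complex.I * (QSeries.lapConst p : ℂ) *
            QSeries.gaussE p ((Real.pi : ℂ) * Complex.I - l) *
              (d n * q ^ (n * (n + 1) / 2) * (-Complex.exp l) ^ n))
          (QSeries.qLaplace p B (l - 2 * (Real.pi : ℂ) * Complex.I)
            - QSeries.qLaplace p B l)) ∧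
        -- the Stokes phenomenon, as an asymptotic expansion when `z → 0`
        (∀ M : ℕ,
          (fun l : ℂ => QSeries.qLaplace p B (l - 2 * (Real.pi : ℂ) * Complex.I)
              - QSeries.qLaplace p B l
              - 2 * (Real.pi : ℂ) * Complex.I * (QSeries.lapConst p : ℂ) *
                QSeries.gaussE p ((Real.pi : ℂ) * Complex.I - l) *
                ∑ n ∈ Finset.range M, d n * q ^ (n * (n + 1) / 2) * (-Complex.exp l) ^ n)
            =O[Filter.comap Complex.re Filter.atBot]
          (fun l : ℂ => QSeries.gaussE p ((Real.pi : ℂ) * Complex.I - l) *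
              Complex.exp l ^ M)) ∧
        -- the re-expansion in `q`-hyperterminants; `Φ N j` is `F_q(1/z; N, q^{-j})`
        ∃ Φ : ℕ → ℕ → ℂ → ℂ,
          (∀ N j : ℕ, QSeries.IsHyperterminantContinuation p N (p ^ (-(j : ℤ))) (Φ N j)) ∧
          (∀ N : ℕ, ‖a‖ * p ^ N < 1 → ‖b‖ * p ^ N < 1 → ∀ l : ℂ,
            HasSum (fun j : ℕ => -(-Complex.exp l) ^ ((N : ℤ) - 1) * (d j * Φ N j l))
              (QSeries.qLaplace p B l
                - ∑ n ∈ Finset.range N, QSeries.phiCoeff [a, b] [] q n * Complex.exp l ^ n)) ∧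
          -- exponential improvement at optimal truncation
          (∀ (Θ K : ℝ) (J : ℕ), ∃ C ρ : ℝ, ∀ (l : ℂ) (N : ℕ),
            |l.im| ≤ Θ → l.re < ρ → |(N : ℝ) - ‖l / (Real.log p : ℂ)‖| ≤ K →
              ‖QSeries.qLaplace p B l
                  - ∑ n ∈ Finset.range N, QSeries.phiCoeff [a, b] [] q n * Complex.exp l ^ n
                  + (-Complex.exp l) ^ ((N : ℤ) - 1) *
                      ∑ j ∈ Finset.range J, d j * Φ N j l‖
                ≤ C * ‖QSeries.gaussE p (-(l.re : ℂ))‖ * Real.exp l.re ^ J)) := by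
  obtain ⟨N₀, hN₀⟩ := QSeries.exists_isLate a b hq1
  have hpole := QSeries.borelSum_principal_part hq0 hq1 hN₀
  refine ⟨QSeries.borelSum a b q N₀, QSeries.resCoeffInt a b q, fun t ht => ⟨?_, ?_⟩,
    QSeries.meromorphicAt_borelSum hq0 hq1 hN₀, fun t ht => ?_, hpole, fun j hj => ?_, rfl,
    QSeries.resCoeff_zero a b q, fun j hj => QSeries.resCoeffInt_recurrence a b hq0 hq1 hj,
    QSeries.lateCoeff_sub_isBigO a b hq0 hq1, ?_⟩
  · have hq : q ≠ 0 := norm_pos_iff.1 hq0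
    refine (QSeries.hasSum_borelSum hq1 hN₀ ht).congr_fun fun n => ?_
    have hqn : q ^ (n * (n - 1) / 2) ≠ 0 := pow_ne_zero _ hq
    rw [QSeries.qBorel, PowerSeries.coeff_mk, QSeries.phiSeries, PowerSeries.coeff_mk,
      QSeries.phiCoeff_two_zero, neg_pow t]
    field_simp
  · simp only [QSeries.phiCoeff_two_one]
    exact QSeries.hasSum_borelSum hq1 hN₀ ht
  · exact QSeries.analyticAt_borelSum hq1 hN₀ fun j h =>
      ht j ((QSeries.one_add_mul_pow_eq_zero_iff hq0 t j).1 h)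
  · obtain ⟨h, hh, he⟩ := hpole j
    exact QSeries.meromorphicOrderAt_eq_neg_one hq0 hj
      (QSeries.meromorphicAt_borelSum hq0 hq1 hN₀ _) hh he
  · rintro p hp0 rfl
    have hp1 : p < 1 := by rwa [QSeries.norm_ofReal_of_pos hp0] at hq1
    refine ⟨QSeries.integrableOn_laplaceIntegrand hp0 hp1 hN₀,
      QSeries.hasSum_stokes hp0 hp1 hN₀, QSeries.stokes_isBigO hp0 hp1 hN₀,
      fun N j => QSeries.hyperCont p N (p ^ (-(j : ℤ))),
      fun N j => QSeries.isHyperterminantContinuation_hyperCont hp0 hp1 N (zpow_pos hp0 _),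
      fun N ha hb l => ?_, QSeries.exists_remainder_bound hp0 hp1 hN₀⟩
    have hN : QSeries.IsLate a b p N := by
      rw [QSeries.IsLate, QSeries.norm_ofReal_of_pos hp0]
      exact ⟨ha, hb⟩
    rw [QSeries.qLaplace_borelSum_eq hp0 hp1 hN₀ hN]
    exact QSeries.hasSum_hyperCont hp0 hp1 hN l
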